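/- Let $\mathfrak g$ be a finite-dimensional complex semisimple Lie algebra, let $e\in\mathfrak g$ be nonzero nilpotent, let $(h,e,f)$ be an $\mathfrak{sl}_2$-triple in $\mathfrak g$ (that is, $[h,e]=2e$, $[h,f]=-2f$, $[e,f]=h$), and for $k\in\mathbb Z$ put $\mathfrak g_k=\{x\in\mathfrak g : [\tfrac12 h,x]=kx\}$. A subalgebra of a Lie algebra $\mathfrak l$ is called toral (in $\mathfrak l$) if $\mathrm{ad}_{\mathfrak l}(x)$ is semisimple for each of its elements $x$; for $\mathfrak s\le\mathfrak l$, a maximal toral subalgebra of $\mathfrak s$ is a maximal one among the subalgebras of $\mathfrak s$ that are toral in $\mathfrak l$. *Gyoja's construction for Lie algebras.* Let $\mathfrak l$ be a reductive Lie algebra, $V$ an $\mathfrak l$-module, $v\in V$ in general position, that is $\mathfrak l\cdot v=V$, and $\mathfrak t_0$ a maximal toral subalgebra of the stabiliser $\mathfrak l_v=\{x\in\mathfrak l : x\cdot v=0\}$. The output is the representation of $\mathfrak l'=\mathfrak n_{\mathfrak l}(\mathfrak t_0)/\mathfrak t_0$ on $V'=V^{\mathfrak t_0}=\{w\in V : \mathfrak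 t_0\cdot w=0\}$ induced by the action of $\mathfrak l$, where $\mathfrak n_{\mathfrak l}(\mathfrak t_0)$ is the normaliser of $\mathfrak t_0$. *Vinberg's construction.* Let $\mathfrak t_0$ be a maximal toral subalgebra of the centraliser of $\{h,e,f\}$ in $\mathfrak g_0$ (toral in $\mathfrak g$), let $\mathfrak t=\mathbb C h\oplus\mathfrak t_0$, let $\lambda\colon\mathfrak t\to\mathbb C$ be given by $[s,e]=\lambda(s)e$, and put $$\mathfrak g(\mathfrak t,e)=\bigoplus_{k\in\mathbb Z}\mathfrak g(\mathfrak t,e)_k,\qquad \mathfrak g(\mathfrak t,e)_k=\{x\in\mathfrak g_k : [s,x]=k\lambda(s)x\text{ for all }s\in\mathfrak t\}.$$ The carrier algebra of $e$ is $\mathfrak c(e)=[\mathfrak g(\mathfrak t,e),\mathfrak g(\mathfrak t,e)]$, with $\mathfrak c(e)_k=\mathfrak c(e)\cap\mathfrak g_k$. The representation associated with $e$ is the adjoint representation of $\mathfrak c(e)_0$ on $\mathfrak c(e)_1$. **Proposition.** Gyoja's construction applies to the Lie algebra $\mathfrak g_0$, the adjoint $\mathfrak g_0$-module $\mathfrak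 g_1$ and the point $e\in\mathfrak g_1$, and it produces Vinberg's étale representation associated with $e$. Precisely: 1. $\mathfrak g_0$ is reductive (its radical is its centre) and $[\mathfrak g_0,e]=\mathfrak g_1$. 2. A subalgebra $\mathfrak t_0$ of $\mathfrak g$ is a maximal toral subalgebra of the centraliser of $\{h,e,f\}$ in $\mathfrak g_0$ (toral in $\mathfrak g$) if and only if it is contained in $\mathfrak g_0$ and is a maximal toral subalgebra of the stabiliser of $e$ in $\mathfrak g_0$ (toral in $\mathfrak g_0$). So the two constructions admit the same choices of $\mathfrak t_0$. 3. For every such $\mathfrak t_0$, the normaliser of $\mathfrak t_0$ in $\mathfrak g_0$ equals its centraliser $\mathfrak z_{\mathfrak g_0}(\mathfrak t_0)$; the subspaces $(\mathfrak g_1)^{\mathfrak t_0}$ and $\mathfrak c(e)_1$ of $\mathfrak g$ are equal; and the inclusion $\mathfrak c(e)_0\subseteq\mathfrak z_{\mathfrak g_0}(\mathfrak t_0)$ induces an isomorphism of Lie algebras $\mathfrak c(e)_0\cong\mathfrak z_{\mathfrak g_0}(\mathfrak t_0)/\mathfrak t_0$. These identify Gyoja's representation of $\mathfrak z_{\mathfrak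 g_0}(\mathfrak t_0)/\mathfrak t_0$ on $(\mathfrak g_1)^{\mathfrak t_0}$ with the adjoint representation of $\mathfrak c(e)_0$ on $\mathfrak c(e)_1$. 4. This representation is étale with $e$ in general position: $e\in\mathfrak c(e)_1$ and $x\mapsto[x,e]$ is a bijection $\mathfrak c(e)_0\to\mathfrak c(e)_1$. -/

import Mathlib

/-! ### Toral subalgebras, reductive and étale data -/

-- the commutator bracket on `End V`
attribute [local instance 100] LieRing.ofAssociativeRing

namespace GyojaVinberg

section General

variable {L V : Type*} [LieRing L] [LieAlgebra ℂ L]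
  [AddCommGroup V] [Module ℂ V] [LieRingModule L V] [LieModule ℂ L V]

/-- A Lie subalgebra `u` of `L` is *toral* if it consists of semisimple elements of `L`, i.e. of
elements whose adjoint action on `L` is semisimple. -/
def IsToral (u : LieSubalgebra ℂ L) : Prop :=
  ∀ x ∈ u, (LieAlgebra.ad ℂ L x).IsSemisimple

/-- `t` is a maximal toral subalgebra of the subalgebra `s` of `L`: it is maximal, with respect to
inclusion, among the toral subalgebras of `L` that are contained in `s`. -/
def IsMaximalToralIn (s t : LieSubalgebra ℂ L) : Prop :=
  Maximal (fun u : LieSubalgebra ℂ L => u ≤ s ∧ IsToral u) t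

/-- The point `v` of the `L`-module `V` is in general position (`V` is prehomogeneous with open
orbit through `v`): `L · v = V`. -/
def IsGeneric (L : Type*) {V : Type*} [LieRing L] [LieAlgebra ℂ L]
    [AddCommGroup V] [Module ℂ V] [LieRingModule L V] (v : V) : Prop :=
  Function.Surjective (fun x : L => ⁅x, v⁆)

/-- The representation `ρ` of `L` on `V` is étale, with `v` in general position: the orbit map
`x ↦ ρ(x) v` is a linear isomorphism from `L` onto `V`. -/
def IsEtaleAt (ρ : L →ₗ⁅ℂ⁆ Module.End ℂ V) (v : V) : Prop :=
  Function.Bijective (fun x : L => ρ x v)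

/-- The stabiliser subalgebra `L_v` of a vector `v`. -/
def stabilizer (L : Type*) {V : Type*} [LieRing L] [LieAlgebra ℂ L]
    [AddCommGroup V] [Module ℂ V] [LieRingModule L V] [LieModule ℂ L V] (v : V) :
    LieSubalgebra ℂ L where
  carrier := {x | ⁅x, v⁆ = 0}
  zero_mem' := by simp
  add_mem' := by
    intro a b ha hb
    simp only [Set.mem_ofPred_eq] at *
    rw [add_lie, ha, hb, add_zero]
  smul_mem' := by
    intro c a ha
    simp only [Set.mem_ofPred_eq] at *
    rw [smul_lie, ha, smul_zero]
  lie_mem' := by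
    intro a b ha hb
    change ⁅a, v⁆ = 0 at ha
    change ⁅b, v⁆ = 0 at hb
    change ⁅⁅a, b⁆, v⁆ = 0
    rw [lie_lie, ha, hb, lie_zero, lie_zero, sub_zero]

/-- The centraliser of a subset `X` of `L`. -/
def centralizer (X : Set L) : LieSubalgebra ℂ L where
  carrier := {y | ∀ x ∈ X, ⁅y, x⁆ = 0}
  zero_mem' := by simp
  add_mem' := by
    intro a b ha hb x hx
    rw [add_lie, ha x hx, hb x hx, add_zero]
  smul_mem' := by
    intro c a ha x hx
    rw [smul_lie, ha x hx, smul_zero]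
  lie_mem' := by
    intro a b ha hb x hx
    rw [lie_lie, ha x hx, hb x hx, lie_zero, lie_zero, sub_zero]

/-! ### Gyoja's construction for Lie algebras

Input: an `L`-module `V`, a vector `v` in general position and a maximal toral subalgebra `t` of
the stabiliser `L_v`.  Output: the Lie algebra `n_L(t) / t` acting on the fixed points `V^t`. -/

/-- `t`, regarded as an ideal of its normaliser `n_L(t)`. -/
def torusIdeal (t : LieSubalgebra ℂ L) : LieIdeal ℂ t.normalizer where
  carrier := {x | (x : L) ∈ t}
  zero_mem' := t.zero_mem
  add_mem' := fun ha hb => t.add_mem ha hb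
  smul_mem' := fun c _ ha => t.smul_mem c ha
  lie_mem := by
    intro x m hm
    exact LieSubalgebra.ideal_in_normalizer x.2 hm

/-- Gyoja's Lie algebra `L' = n_L(t) / t`. -/
abbrev GyojaAlgebra (t : LieSubalgebra ℂ L) : Type _ :=
  t.normalizer ⧸ torusIdeal t

/-- Gyoja's module `V' = V^t`, the vectors annihilated by `t`; it is stable under `n_L(t)`. -/
def fixedPoints (V : Type*) [AddCommGroup V] [Module ℂ V] [LieRingModule L V] [LieModule ℂ L V]
    (t : LieSubalgebra ℂ L) : LieSubmodule ℂ t.normalizer V where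
  carrier := {v | ∀ s ∈ t, ⁅s, v⁆ = 0}
  zero_mem' := by simp
  add_mem' := by
    intro a b ha hb s hs
    rw [lie_add, ha s hs, hb s hs, add_zero]
  smul_mem' := by
    intro c a ha s hs
    rw [lie_smul, ha s hs, smul_zero]
  lie_mem := by
    intro x m hm s hs
    change ⁅s, ⁅(x : L), m⁆⁆ = 0
    rw [leibniz_lie, hm s hs, lie_zero, add_zero]
    exact hm _ ((t.mem_normalizer_iff' (x : L)).mp x.2 s hs)

/-- Gyoja's representation of `L' = n_L(t) / t` on `V' = V^t`: the class of `x ∈ n_L(t)` acts as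
`x`. -/
def gyojaRep (V : Type*) [AddCommGroup V] [Module ℂ V] [LieRingModule L V] [LieModule ℂ L V]
    (t : LieSubalgebra ℂ L) :
    GyojaAlgebra t →ₗ⁅ℂ⁆ Module.End ℂ (fixedPoints V t) :=
  { (torusIdeal t).toSubmodule.liftQ
      (LieModule.toEnd ℂ t.normalizer (fixedPoints V t) : t.normalizer →ₗ[ℂ] _) (by
        intro x hx
        rw [LinearMap.mem_ker]
        ext v
        exact v.2 _ hx) with
    map_lie' := by
      intro x y
      obtain ⟨x, rfl⟩ := LieSubmodule.Quotient.surjective_mk' _ x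
      obtain ⟨y, rfl⟩ := LieSubmodule.Quotient.surjective_mk' _ y
      exact (LieModule.toEnd ℂ t.normalizer (fixedPoints V t)).map_lie x y }

theorem gyojaRep_mk_apply (t : LieSubalgebra ℂ L) (x : t.normalizer) (v : fixedPoints V t) :
    gyojaRep V t (LieSubmodule.Quotient.mk x) v = ⁅x, v⁆ := rfl

end General

/-! ### The grading by `ad (h/2)` and Vinberg's construction -/

section Graded

variable {g : Type*} [LieRing g] [LieAlgebra ℂ g]

/-- The homogeneous component `g_k = {x : [h/2, x] = k x}` of degree `k`. -/
def gr (h : g) (k : ℤ) : Submodule ℂ g where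
  carrier := {x | ⁅(2⁻¹ : ℂ) • h, x⁆ = (k : ℂ) • x}
  zero_mem' := by simp
  add_mem' := by
    intro a b ha hb
    simp only [Set.mem_ofPred_eq] at *
    rw [lie_add, ha, hb, smul_add]
  smul_mem' := by
    intro c a ha
    simp only [Set.mem_ofPred_eq] at *
    rw [lie_smul, ha, smul_comm]

theorem mem_gr {h : g} {k : ℤ} {x : g} :
    x ∈ gr h k ↔ ⁅(2⁻¹ : ℂ) • h, x⁆ = (k : ℂ) • x := Iff.rfl

theorem lie_mem_gr {h x y : g} {k l : ℤ} (hx : x ∈ gr h k) (hy : y ∈ gr h l) :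
    ⁅x, y⁆ ∈ gr h (k + l) := by
  rw [mem_gr] at *
  rw [leibniz_lie, hx, hy, smul_lie, lie_smul, Int.cast_add, add_smul]

/-- The Lie subalgebra `g_0`. -/
def gr0 (h : g) : LieSubalgebra ℂ g :=
  { gr h 0 with
    lie_mem' := fun {x y} hx hy => by simpa using lie_mem_gr (k := 0) (l := 0) hx hy }

/-- The adjoint `g_0`-module `g_1`. -/
def gr1 (h : g) : LieSubmodule ℂ (gr0 h) g :=
  { gr h 1 with
    lie_mem := fun {x y} hy => by simpa using lie_mem_gr (k := 0) (l := 1) x.2 hy }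

/-- In an `sl₂`-triple `(h, e, f)` the element `e` has degree `1`. -/
theorem e_mem_gr1 {h e f : g} (t : IsSl2Triple h e f) : e ∈ gr1 h := by
  change ⁅(2⁻¹ : ℂ) • h, e⁆ = ((1 : ℤ) : ℂ) • e
  rw [smul_lie, t.lie_h_e_smul ℂ, smul_smul]
  norm_num

/-- The subspace `t = ℂ h ⊕ t₀`. -/
def vinbergTorus (h : g) (t₀ : LieSubalgebra ℂ g) : Submodule ℂ g :=
  Submodule.span ℂ {h} ⊔ t₀.toSubmodule

/-- Every `s ∈ t = ℂ h ⊕ t₀` satisfies `[s, e] = λ(s) e` for exactly one scalar `λ(s)`. -/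
theorem existsUnique_lambda {h e f : g} (hs : IsSl2Triple h e f) {t₀ : LieSubalgebra ℂ g}
    (ht : t₀ ≤ centralizer {h, e, f}) {s : g} (hst : s ∈ vinbergTorus h t₀) :
    ∃! c : ℂ, ⁅s, e⁆ = c • e := by
  obtain ⟨a, ha, b, hb, rfl⟩ := Submodule.mem_sup.mp hst
  obtain ⟨r, rfl⟩ := Submodule.mem_span_singleton.mp ha
  have hbe : ⁅b, e⁆ = 0 := ht hb e (by simp)
  refine ⟨r * 2, ?_, fun c hc => ?_⟩
  · change ⁅r • h + b, e⁆ = (r * 2) • e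
    rw [add_lie, hbe, smul_lie, hs.lie_h_e_smul ℂ, smul_smul, add_zero]
  · change ⁅r • h + b, e⁆ = c • e at hc
    rw [add_lie, hbe, smul_lie, hs.lie_h_e_smul ℂ, smul_smul, add_zero] at hc
    exact (smul_left_injective ℂ hs.e_ne_zero hc).symm

/-- The component `g(t,e)_k = {x ∈ g_k : [s, x] = k λ(s) x for all s ∈ t}`, where `λ(s)` is the
scalar `c` with `[s, e] = c e`, which exists and is unique for `s ∈ t` by
`existsUnique_lambda`. -/
def vinbergPiece (h e : g) (t₀ : LieSubalgebra ℂ g) (k : ℤ) : Submodule ℂ g where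
  carrier := {x | x ∈ gr h k ∧
    ∀ s ∈ vinbergTorus h t₀, ∀ c : ℂ, ⁅s, e⁆ = c • e → ⁅s, x⁆ = ((k : ℂ) * c) • x}
  zero_mem' := ⟨Submodule.zero_mem _, by simp⟩
  add_mem' := by
    rintro a b ⟨ha, ha'⟩ ⟨hb, hb'⟩
    refine ⟨Submodule.add_mem _ ha hb, fun s hs c hc => ?_⟩
    rw [lie_add, ha' s hs c hc, hb' s hs c hc, smul_add]
  smul_mem' := by
    rintro r a ⟨ha, ha'⟩
    refine ⟨Submodule.smul_mem _ r ha, fun s hs c hc => ?_⟩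
    rw [lie_smul, ha' s hs c hc, smul_comm]

theorem lie_mem_vinbergPiece {h e : g} {t₀ : LieSubalgebra ℂ g} {x y : g} {k l : ℤ}
    (hx : x ∈ vinbergPiece h e t₀ k) (hy : y ∈ vinbergPiece h e t₀ l) :
    ⁅x, y⁆ ∈ vinbergPiece h e t₀ (k + l) := by
  refine ⟨lie_mem_gr hx.1 hy.1, fun s hs c hc => ?_⟩
  rw [leibniz_lie, hx.2 s hs c hc, hy.2 s hs c hc, smul_lie, lie_smul, ← add_smul]
  push_cast
  ring_nf

/-- The Lie algebra `g(t,e) = ⨁ₖ g(t,e)_k`; the sum is direct because its terms lie in different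
eigenspaces of `ad (h/2)`. -/
def vinbergAlgebra (h e : g) (t₀ : LieSubalgebra ℂ g) : LieSubalgebra ℂ g :=
  { (⨆ k : ℤ, vinbergPiece h e t₀ k : Submodule ℂ g) with
    lie_mem' := by
      intro x y hx hy
      change x ∈ ⨆ k : ℤ, vinbergPiece h e t₀ k at hx
      change y ∈ ⨆ k : ℤ, vinbergPiece h e t₀ k at hy
      change ⁅x, y⁆ ∈ ⨆ k : ℤ, vinbergPiece h e t₀ k
      induction hx using Submodule.iSup_induction' with
      | zero => simp
      | add a b _ _ ha hb => rw [add_lie]; exact Submodule.add_mem _ ha hb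
      | mem k a ha =>
        induction hy using Submodule.iSup_induction' with
        | zero => simp
        | add b c _ _ hb hc => rw [lie_add]; exact Submodule.add_mem _ hb hc
        | mem l b hb => exact Submodule.mem_iSup_of_mem (k + l) (lie_mem_vinbergPiece ha hb) }

/-- The carrier algebra `c(e) = [g(t,e), g(t,e)]`, as a subalgebra of `g`. -/
def carrierAlgebra (h e : g) (t₀ : LieSubalgebra ℂ g) : LieSubalgebra ℂ g :=
  LieSubalgebra.map (vinbergAlgebra h e t₀).incl
    (LieIdeal.toLieSubalgebra ℂ (vinbergAlgebra h e t₀)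
      (LieAlgebra.derivedSeries ℂ (vinbergAlgebra h e t₀) 1))

/-- The degree-`0` part `c(e)_0 = c(e) ∩ g_0` of the carrier algebra. -/
def carrier0 (h e : g) (t₀ : LieSubalgebra ℂ g) : LieSubalgebra ℂ g :=
  carrierAlgebra h e t₀ ⊓ gr0 h

/-- The degree-`1` part `c(e)_1 = c(e) ∩ g_1` of the carrier algebra, as a module under the adjoint
action of `c(e)_0`. -/
def carrier1 (h e : g) (t₀ : LieSubalgebra ℂ g) : LieSubmodule ℂ (carrier0 h e t₀) g :=
  { (carrierAlgebra h e t₀).toSubmodule ⊓ gr h 1 with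
    lie_mem := fun {x y} hy =>
      ⟨(carrierAlgebra h e t₀).lie_mem x.2.1 hy.1,
        by simpa using lie_mem_gr (k := 0) (l := 1) x.2.2 hy.2⟩ }

/-- Vinberg's representation: the adjoint action of `c(e)_0` on `c(e)_1`. -/
def vinbergRep (h e : g) (t₀ : LieSubalgebra ℂ g) :
    carrier0 h e t₀ →ₗ⁅ℂ⁆ Module.End ℂ (carrier1 h e t₀) :=
  LieModule.toEnd ℂ (carrier0 h e t₀) (carrier1 h e t₀)

theorem vinbergRep_apply_coe {h e : g} {t₀ : LieSubalgebra ℂ g} (x : carrier0 h e t₀)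
    (w : carrier1 h e t₀) : ((vinbergRep h e t₀ x w : carrier1 h e t₀) : g) = ⁅(x : g), (w : g)⁆ :=
  rfl

end Graded

end GyojaVinberg

/-! ### Representations of `sl₂` -/

namespace IsSl2Triple

open LieModule

variable {K L M : Type*} [Field K] [CharZero K] [LieRing L] [LieAlgebra K L]
  [AddCommGroup M] [Module K M] [LieRingModule L M] [LieModule K L M] {h e f : L}

/-! The key is that the Killing form of g stays nondegenerate on three subalgebras: g_0, the
centraliser z of {h, e, f}, and the centraliser m of t₀ in z. For g_0 and m this holds because h and
the elements of t₀ act without nilpotent part, so that kernel and image of each are complementary,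
and by invariance they are orthogonal. For z it follows from g_0 = z + [f, g_1].

Nondegeneracy on g_0 makes g_0 reductive and makes "toral in g_0" agree with "toral in g". A vector
of weight 0 killed by e is killed by f, so the stabiliser of e in g_0 is z; hence the admissible
tori agree.

Nondegeneracy on m gives m = t₀ (`IsMaximalToralIn.mem_of_forall_lie_eq_zero`): semisimple parts of
elements of m lie in t₀ by maximality, so m is nilpotent by Engel, and an ad-nilpotent element of a
solvable subalgebra is Killing-orthogonal to that subalgebra.

Finally, the centraliser of t₀ in g contains the triple, and sl₂ theory splits its weight-0 part as
(kernel of e) + [f, g_1^{t₀}]. The kernel is m = t₀ and the other term lies in c(e)_0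
(`exists_eq_add_mem_carrier0`). By invariance c(e) is orthogonal to t₀, on which the form is
nondegenerate, so c(e) ∩ t₀ = 0 (`eq_zero_of_mem_carrierAlgebra_of_mem`). Thus c(e)_0 is a
complement of t₀ in the centraliser of t₀ in g_0. The map x ↦ [x, e] sends that centraliser onto
g_1^{t₀} = c(e)_1 with kernel t₀, whence étaleness. -/

theorem lie_h_pow_f (t : IsSl2Triple h e f) (j : ℕ) (x : M) :
    ⁅h, (toEnd K L M f ^ j) x⁆ =
      (toEnd K L M f ^ j) ⁅h, x⁆ - (2 * j : K) • (toEnd K L M f ^ j) x := by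
  induction j with
  | zero => simp
  | succ j ih =>
    simp only [pow_succ', Module.End.mul_apply, toEnd_apply_apply]
    rw [leibniz_lie, ih, t.lie_lie_smul_f K, neg_lie, smul_lie, lie_sub, lie_smul]
    push_cast
    module

theorem lie_e_pow_succ_f (t : IsSl2Triple h e f) (j : ℕ) (x : M) :
    ⁅e, (toEnd K L M f ^ (j + 1)) x⁆ = (toEnd K L M f ^ (j + 1)) ⁅e, x⁆ +
      (j + 1 : K) • (toEnd K L M f ^ j) (⁅h, x⁆ - (j : K) • x) := by
  induction j with
  | zero => simp [leibniz_lie e f x, t.lie_e_f, add_comm]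
  | succ j ih =>
    have hf : ∀ (n : ℕ) (y : M), ⁅f, (toEnd K L M f ^ n) y⁆ = (toEnd K L M f ^ (n + 1)) y :=
      fun n y => by simp [pow_succ']
    rw [← hf (j + 1) x, leibniz_lie, ih, t.lie_e_f, t.lie_h_pow_f, lie_add, lie_smul, hf, hf]
    simp only [map_sub, map_smul, Nat.cast_add, Nat.cast_one]
    module

variable [FiniteDimensional K M]

/-- The nonzero vectors among the eⁿ m are eigenvectors of h for the distinct eigenvalues μ + 2n, so
only finitely many can occur. -/
theorem exists_pow_e_eq_zero (t : IsSl2Triple h e f) {m : M} {μ : K} (hm : ⁅h, m⁆ = μ • m) :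
    ∃ n : ℕ, (toEnd K L M e ^ n) m = 0 := by
  by_contra! contra
  have hinj : Function.Injective fun n : ℕ => μ + 2 * (n : K) := fun a b hab => by
    simpa using hab
  have := (Module.End.eigenvectors_linearIndependent' (toEnd K L M h) _ hinj
    (fun n => (toEnd K L M e ^ n) m) fun n =>
      ⟨Module.End.mem_eigenspace_iff.mpr (t.lie_h_pow_toEnd_e hm n), contra n⟩).finite
  exact not_finite ℕ

/-- Some power of e kills v, and the exponent can be lowered to 0: if e^(j+1) v = 0, the commutator
of f with e^(j+1) leaves a multiple of e^j v, with factor (j+1)(-(k+1)-j) ≠ 0. -/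
theorem eq_zero_of_lie_e_lie_f_eq_zero (t : IsSl2Triple h e f) {v : M} {k : ℕ}
    (hv : ⁅h, v⁆ = (k + 1 : K) • v) (hef : ⁅e, ⁅f, v⁆⁆ = 0) : v = 0 := by
  have key : ∀ j : ℕ, (toEnd K L M e ^ j) v = 0 → v = 0 := by
    intro j
    induction j with
    | zero => simp
    | succ j ih =>
      intro hj
      refine ih ?_
      have h1 := t.symm.lie_e_pow_succ_f (K := K) j v
      rw [hj, lie_zero, pow_succ, Module.End.mul_apply, toEnd_apply_apply, hef, map_zero, neg_lie,
        hv, zero_add, ← neg_smul, ← sub_smul, map_smul, smul_smul, eq_comm, smul_eq_zero] at h1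
      refine h1.resolve_left (mul_ne_zero (Nat.cast_add_one_ne_zero j) ?_)
      rw [show -((k : K) + 1) - j = -((k + 1 + j : ℕ) : K) by push_cast; ring, neg_ne_zero,
        Nat.cast_ne_zero]
      omega
  obtain ⟨n, hn⟩ := t.exists_pow_e_eq_zero hv
  exact key n hn

/-- The operator ef preserves the eigenspace of h and is injective there, hence surjective by finite
dimension. -/
theorem exists_lie_e_lie_f_eq (t : IsSl2Triple h e f) {v : M} {k : ℕ}
    (hv : ⁅h, v⁆ = (k + 1 : K) • v) : ∃ w : M, ⁅h, w⁆ = (k + 1 : K) • w ∧ ⁅e, ⁅f, w⁆⁆ = v := by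
  set E := (toEnd K L M h).eigenspace (k + 1 : K)
  have hE : ∀ w, w ∈ E ↔ ⁅h, w⁆ = (k + 1 : K) • w := fun w => Module.End.mem_eigenspace_iff
  have hst : ∀ w ∈ E, (toEnd K L M e ∘ₗ toEnd K L M f) w ∈ E := by
    intro w hw
    rw [hE] at hw ⊢
    simp only [LinearMap.comp_apply, toEnd_apply_apply]
    rw [leibniz_lie h e, leibniz_lie h f, hw, t.lie_h_e_smul K, t.lie_lie_smul_f K]
    simp only [neg_lie, smul_lie, lie_add, lie_neg, lie_smul]
    module
  have hinj : Function.Injective ((toEnd K L M e ∘ₗ toEnd K L M f).restrict hst) := by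
    rw [← LinearMap.ker_eq_bot, LinearMap.ker_eq_bot']
    rintro ⟨w, hw⟩ h0
    exact Subtype.ext (t.eq_zero_of_lie_e_lie_f_eq_zero ((hE w).mp hw) (congrArg Subtype.val h0))
  obtain ⟨⟨w, hw⟩, h0⟩ := LinearMap.surjective_of_injective hinj ⟨v, (hE v).mpr hv⟩
  exact ⟨w, (hE w).mp hw, congrArg Subtype.val h0⟩

/-- The weight spaces of nonnegative integral weight of a module over `sl₂` split as the kernel of
`e` plus the image of `f`. -/
theorem exists_eq_add_lie_f (t : IsSl2Triple h e f) {v : M} {k : ℕ}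
    (hv : ⁅h, v⁆ = (k : K) • v) : ∃ u w : M, v = u + ⁅f, w⁆ ∧ ⁅h, u⁆ = (k : K) • u ∧ ⁅e, u⁆ = 0 ∧
      ⁅h, w⁆ = (k + 2 : K) • w := by
  have hev : ⁅h, ⁅e, v⁆⁆ = ((k + 1 : ℕ) + 1 : K) • ⁅e, v⁆ := by
    rw [leibniz_lie, hv, t.lie_h_e_smul K, smul_lie, lie_smul]
    push_cast
    module
  -- The vector e v has positive weight k + 2, so e v = e f w for some w of that weight; then u = v
  -- - f w is killed by e.
  obtain ⟨w, hw, hw'⟩ := t.exists_lie_e_lie_f_eq hev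
  have hw2 : ⁅h, w⁆ = (k + 2 : K) • w := by
    rw [hw]; push_cast; module
  refine ⟨v - ⁅f, w⁆, w, by abel, ?_, by rw [lie_sub, hw', sub_self], hw2⟩
  rw [lie_sub, hv, leibniz_lie, hw2, t.lie_lie_smul_f K, neg_lie, smul_lie, lie_smul]
  module

theorem exists_lie_e_eq (t : IsSl2Triple h e f) {v : M} (hv : ⁅h, v⁆ = (2 : K) • v) :
    ∃ w : M, ⁅h, w⁆ = 0 ∧ ⁅e, w⁆ = v := by
  have hv' : ⁅h, v⁆ = ((1 : ℕ) + 1 : K) • v := by rw [hv]; norm_num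
  obtain ⟨w, hw, rfl⟩ := t.exists_lie_e_lie_f_eq hv'
  refine ⟨⁅f, w⁆, ?_, rfl⟩
  rw [leibniz_lie, hw, t.lie_lie_smul_f K, neg_lie, smul_lie, lie_smul]
  push_cast
  module

/-- Otherwise f v would be a primitive vector of weight -2, but weights of primitive vectors are
natural numbers. -/
theorem lie_f_eq_zero (t : IsSl2Triple h e f) {v : M} (hv : ⁅h, v⁆ = (0 : K) • v) (he : ⁅e, v⁆ = 0) :
    ⁅f, v⁆ = 0 := by
  rw [zero_smul] at hv
  by_contra h0
  have P : t.HasPrimitiveVectorWith ⁅f, v⁆ (-2 : K) :=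
    { ne_zero := h0
      lie_h := by
        rw [leibniz_lie, hv, t.lie_lie_smul_f K, neg_lie, smul_lie, lie_zero]
        module
      lie_e := by rw [leibniz_lie, he, t.lie_e_f, hv, lie_zero, add_zero] }
  obtain ⟨n, hn⟩ := P.exists_nat
  have : ((n + 2 : ℕ) : K) = 0 := by push_cast; rw [← hn]; ring
  rw [Nat.cast_eq_zero] at this
  omega

/-- The element `h` acts without nilpotent part on the vectors annihilated by a power of `e`, at
nonnegative integral weights. -/
theorem lie_h_eq_smul_of_sq (t : IsSl2Triple h e f) (m : ℕ) :
    ∀ (k : ℕ) (v : M), (toEnd K L M e ^ m) v = 0 →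
      ⁅h, ⁅h, v⁆ - (k : K) • v⁆ = (k : K) • (⁅h, v⁆ - (k : K) • v) → ⁅h, v⁆ = (k : K) • v := by
  induction m with
  | zero =>
    intro k v h0 _
    obtain rfl : v = 0 := by simpa using h0
    simp
  | succ m ih =>
    intro k v h0 hv
    have hev : ⁅h, ⁅e, v⁆⁆ = ((k + 2 : ℕ) : K) • ⁅e, v⁆ := by
      have hcomm : ∀ w : M, ⁅h, ⁅e, w⁆⁆ = ⁅e, ⁅h, w⁆⁆ + (2 : K) • ⁅e, w⁆ := fun w => by
        rw [leibniz_lie, t.lie_h_e_smul K, smul_lie, add_comm]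
      -- The vector e v is killed by one power of e fewer, at weight k + 2; this is why the
      -- induction quantifies over all k.
      refine ih (k + 2) ⁅e, v⁆ (by simpa [pow_succ] using h0) ?_
      have h1 : ⁅h, ⁅e, v⁆⁆ - ((k + 2 : ℕ) : K) • ⁅e, v⁆ = ⁅e, ⁅h, v⁆ - (k : K) • v⁆ := by
        rw [hcomm, lie_sub, lie_smul]; push_cast; module
      rw [h1, hcomm, hv, lie_smul]
      push_cast
      module
    obtain ⟨w, hw, hw'⟩ := t.exists_lie_e_lie_f_eq (K := K) (k := k + 1) (v := ⁅e, v⁆) (by rw [hev]; push_cast; module)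
    have hfw : ⁅h, ⁅f, w⁆⁆ = (k : K) • ⁅f, w⁆ := by
      rw [leibniz_lie, hw, t.lie_lie_smul_f K, neg_lie, smul_lie, lie_smul]
      push_cast
      module
    -- Subtracting the genuine weight vector f w makes x primitive up to the defect: e x = 0 and h x
    -- = k x + y, where y is killed by e and has weight k.
    set x := v - ⁅f, w⁆ with hx
    set y := ⁅h, v⁆ - (k : K) • v with hy
    have hex : ⁅e, x⁆ = 0 := by rw [hx, lie_sub, hw', sub_self]
    have hxy : ⁅h, x⁆ = (k : K) • x + y := by rw [hx, hy, lie_sub, hfw]; module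
    have hey : ⁅e, y⁆ = 0 := by
      rw [hy, lie_sub, lie_smul]
      have : ⁅e, ⁅h, v⁆⁆ = ⁅h, ⁅e, v⁆⁆ - (2 : K) • ⁅e, v⁆ := by
        rw [leibniz_lie h e v, t.lie_h_e_smul K, smul_lie]; abel
      rw [this, hev]; push_cast; module
    by_contra hne
    have P : t.HasPrimitiveVectorWith y (k : K) :=
      { ne_zero := fun hy0 => hne (sub_eq_zero.mp hy0)
        lie_h := hv
        lie_e := hey }
    set z := (toEnd K L M f ^ (k + 1)) x with hz
    have hez : ⁅e, z⁆ = (k + 1 : K) • (toEnd K L M f ^ k) y := by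
      rw [hz, t.lie_e_pow_succ_f, hex, map_zero, zero_add, hxy]; simp
    have hfy : (toEnd K L M f ^ (k + 1)) y = 0 := P.pow_toEnd_f_eq_zero_of_eq_nat rfl
    -- If y ≠ 0, then f^(k+1) y = 0, so z = f^(k+1) x is a true weight vector, of weight k - 2(k+1)
    -- = -(k+2), and f e z = 0. Injectivity of fe at negative weights gives z = 0, so e z = (k+1)
    -- f^k y = 0, contradicting f^k y ≠ 0.
    have hz0 : z = 0 := by
      refine t.symm.eq_zero_of_lie_e_lie_f_eq_zero (K := K) (k := k + 1) ?_ ?_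
      · rw [neg_lie, hz, t.lie_h_pow_f, hxy, map_add, hfy, map_smul]
        push_cast
        module
      · rw [hez, lie_smul, P.lie_f_pow_toEnd_f, hfy, smul_zero]
    rw [hz0, lie_zero, eq_comm, smul_eq_zero] at hez
    exact P.pow_toEnd_f_ne_zero_of_eq_nat rfl le_rfl
      (hez.resolve_left (Nat.cast_add_one_ne_zero k))

theorem lie_h_eq_zero_of_lie_h_lie_h_eq_zero (t : IsSl2Triple h e f)
    (he : IsNilpotent (toEnd K L M e)) {v : M} (hv : ⁅h, ⁅h, v⁆⁆ = 0) : ⁅h, v⁆ = 0 := by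
  obtain ⟨m, hm⟩ := he
  simpa using t.lie_h_eq_smul_of_sq (K := K) m 0 v (by simp [hm]) (by simpa using hv)

end IsSl2Triple

/-! ### Solvable ideals and trace forms -/

namespace LieModule

open LieAlgebra

variable {K L : Type*} [Field K] [CharZero K] [IsAlgClosed K] [LieRing L] [LieAlgebra K L]
  [FiniteDimensional K L]

/-- A weight of the radical on a nonzero module has a weight space stable under the whole algebra,
and it vanishes on brackets `⁅l, r⁆`. -/
theorem exists_lieSubmodule_radical_weight (V : Type*) [AddCommGroup V] [Module K V]
    [LieRingModule L V] [LieModule K L V] [FiniteDimensional K V] [Nontrivial V] :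
    ∃ (W : LieSubmodule K L V) (χ : radical K L → K), W ≠ ⊥ ∧
      ∀ (x : radical K L), ∀ w ∈ W, ⁅(x : L), w⁆ = χ x • w := by
  -- Lie's theorem for the radical; in characteristic zero the weight space of an ideal is stable
  -- under all of L.
  obtain ⟨χ, hχ⟩ : ∃ χ : Module.Dual K (radical K L), Nontrivial (weightSpace V χ) :=
    exists_nontrivial_weightSpace_of_isSolvable K (radical K L) V
  let W : LieSubmodule K L V := weightSpaceOfIsLieTower K V χ
  refine ⟨W, χ, ?_, fun x w hw => ?_⟩
  · rintro h0
    obtain ⟨w, hw⟩ := exists_ne (0 : weightSpace V χ)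
    refine hw (Subtype.ext ?_)
    have hwW : (w : V) ∈ W := w.2
    rw [h0] at hwW
    exact (LieSubmodule.mem_bot _).mp hwW
  · have h : ∀ (y : L) (hy : y ∈ radical K L), ⁅y, w⁆ = χ ⟨y, hy⟩ • w := by
      simpa [W, weightSpaceOfIsLieTower, mem_weightSpace] using hw
    exact h x x.2

variable {V : Type*} [AddCommGroup V] [Module K V] [LieRingModule L V] [LieModule K L V]
  [FiniteDimensional K V]

/-- An element of the radical which either is a bracket `⁅l, r⁆` with `r` in the radical, or acts
nilpotently, lowers some `L`-stable filtration of a module. -/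
theorem exists_lt_lie_mem_of_mem_radical {x : L} (hx : x ∈ radical K L)
    (h : (∃ l : L, ∃ r ∈ radical K L, ⁅l, r⁆ = x) ∨ _root_.IsNilpotent (toEnd K L V x))
    (N : LieSubmodule K L V) (hN : N ≠ ⊤) :
    ∃ N' : LieSubmodule K L V, N < N' ∧ ∀ v ∈ N', ⁅x, v⁆ ∈ N := by
  have : Nontrivial (V ⧸ N) := Submodule.Quotient.nontrivial_iff.mpr (by simpa using hN)
  have hmk : ∀ v : V, LieSubmodule.Quotient.mk' N v = 0 ↔ v ∈ N := fun v =>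
    LieSubmodule.Quotient.mk_eq_zero' (N := N)
  obtain ⟨W, χ, hW, hχ⟩ := exists_lieSubmodule_radical_weight (K := K) (L := L) (V ⧸ N)
  obtain ⟨w, hwW, hw0⟩ : ∃ w ∈ W, w ≠ 0 := by
    by_contra! h0
    exact hW ((LieSubmodule.eq_bot_iff W).mpr h0)
  have hxw : ∀ w ∈ W, ⁅x, w⁆ = 0 := by
    -- On W the radical acts by scalars. A bracket of l with the scalar action of r vanishes, and a
    -- nilpotent scalar is zero.
    have hχ0 : χ ⟨x, hx⟩ = 0 := by
      rcases h with ⟨l, r, hr, rfl⟩ | hnil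
      · have h1 := hχ ⟨_, hx⟩ w hwW
        have h2 := hχ ⟨r, hr⟩ w hwW
        have h3 := hχ ⟨r, hr⟩ _ (W.lie_mem (x := l) hwW)
        simp only at h1 h2 h3
        rw [lie_lie, h2, h3, lie_smul, sub_self, eq_comm, smul_eq_zero] at h1
        exact h1.resolve_right hw0
      · obtain ⟨n, hn⟩ := hnil
        have h1 : ∀ (k : ℕ) (v : V), (toEnd K L (V ⧸ N) x ^ k) (LieSubmodule.Quotient.mk' N v) =
            LieSubmodule.Quotient.mk' N ((toEnd K L V x ^ k) v) := by
          intro k v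
          induction k with
          | zero => simp
          | succ k ih =>
            rw [pow_succ', pow_succ', Module.End.mul_apply, Module.End.mul_apply, ih,
              toEnd_apply_apply, toEnd_apply_apply, LieModuleHom.map_lie]
        have h2 : ∀ k : ℕ, (toEnd K L (V ⧸ N) x ^ k) w = χ ⟨x, hx⟩ ^ k • w := by
          intro k
          induction k with
          | zero => simp
          | succ k ih =>
            rw [pow_succ', Module.End.mul_apply, ih, map_smul, toEnd_apply_apply,
              hχ ⟨x, hx⟩ w hwW, smul_smul, pow_succ]
        obtain ⟨v, rfl⟩ := LieSubmodule.Quotient.surjective_mk' N w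
        have h3 := h2 n
        rw [h1, hn, LinearMap.zero_apply, map_zero, eq_comm, smul_eq_zero] at h3
        exact eq_zero_of_pow_eq_zero (h3.resolve_right hw0)
    intro u hu
    rw [hχ ⟨x, hx⟩ u hu, hχ0, zero_smul]
  refine ⟨W.comap (LieSubmodule.Quotient.mk' N), lt_of_le_of_ne ?_ ?_, ?_⟩
  · intro v hv
    rw [LieSubmodule.mem_comap, (hmk v).mpr hv]
    exact W.zero_mem
  · intro hE
    obtain ⟨v, rfl⟩ := LieSubmodule.Quotient.surjective_mk' N w
    have : v ∈ N := by rw [hE]; exact hwW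
    exact hw0 ((hmk v).mpr this)
  · intro v hv
    rw [← hmk, LieModuleHom.map_lie]
    exact hxw _ hv

/-- Take a largest submodule N on which some power of xy vanishes. If N were proper, x would map a
larger submodule N' into N; as y preserves N', one more power of xy would vanish on N'. -/
theorem isNilpotent_toEnd_mul_of_mem_radical {x : L} (hx : x ∈ radical K L)
    (h : (∃ l : L, ∃ r ∈ radical K L, ⁅l, r⁆ = x) ∨ _root_.IsNilpotent (toEnd K L V x)) (y : L) :
    _root_.IsNilpotent (toEnd K L V x * toEnd K L V y) := by
  set T := toEnd K L V x * toEnd K L V y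
  let S : Set (LieSubmodule K L V) := {N | ∃ k : ℕ, ∀ v ∈ N, (T ^ k) v = 0}
  obtain ⟨N, ⟨k, hk⟩, hmax⟩ := (wellFounded_gt (α := LieSubmodule K L V)).has_min S
    ⟨⊥, 0, by simp⟩
  have hN : N = ⊤ := by
    by_contra hN
    obtain ⟨N', hlt, hN'⟩ := exists_lt_lie_mem_of_mem_radical hx h N hN
    refine hmax N' ⟨k + 1, fun v hv => ?_⟩ hlt
    rw [pow_succ, Module.End.mul_apply]
    exact hk _ (hN' _ (N'.lie_mem hv))
  exact ⟨k, LinearMap.ext fun v => hk v (hN ▸ LieSubmodule.mem_top v)⟩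

end LieModule

/-! ### Semisimple endomorphisms and the Jordan decomposition in a Killing Lie algebra -/

theorem Module.End.IsSemisimple.apply_eq_zero_of_sq {K V : Type*} [Field K] [AddCommGroup V]
    [Module K V] {f : Module.End K V} (hf : f.IsSemisimple) {v : V} (hv : f (f v) = 0) :
    f v = 0 := by
  have h := hf.isFinitelySemisimple.genEigenspace_eq_eigenspace 0 (k := 2) (by norm_num)
  have : v ∈ f.genEigenspace 0 ((2 : ℕ) : ℕ∞) := by
    rw [Module.End.mem_genEigenspace_nat]
    simp [pow_two, hv]
  rw [show ((2 : ℕ) : ℕ∞) = 2 from rfl, h, Module.End.mem_eigenspace_iff, zero_smul] at this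
  exact this

theorem LinearMap.codisjoint_ker_range_of_sq {K V : Type*} [Field K] [AddCommGroup V] [Module K V]
    [FiniteDimensional K V] (f : V →ₗ[K] V) (hf : ∀ v, f (f v) = 0 → f v = 0) :
    LinearMap.ker f ⊔ LinearMap.range f = ⊤ := by
  refine Submodule.eq_top_of_disjoint _ _ ?_ ?_
  · rw [add_comm, LinearMap.finrank_range_add_finrank_ker]
  · rw [Submodule.disjoint_def]
    rintro _ hx ⟨v, rfl⟩
    exact hf v hx

namespace LieAlgebra

variable {K L : Type*} [Field K] [LieRing L] [LieAlgebra K L] [FiniteDimensional K L]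

/-- The semisimple part of an inner derivation is a derivation. -/
theorem leibniz_of_commute_ad_of_isNilpotent [IsAlgClosed K] {x : L} {s : Module.End K L}
    (hc : Commute (ad K L x) s) (hs : s.IsSemisimple) (hn : IsNilpotent (ad K L x - s)) (a b : L) :
    s ⁅a, b⁆ = ⁅s a, b⁆ + ⁅a, s b⁆ := by
  have key : ∀ (μ : K) (v : L), v ∈ (ad K L x).maxGenEigenspace μ → s v = μ • v := fun μ v hv =>
    Module.End.apply_eq_of_mem_of_comm_of_isFinitelySemisimple_of_isNil hv hc
      hs.isFinitelySemisimple hn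
  have htop := Module.End.iSup_maxGenEigenspace_eq_top (ad K L x)
  have ha : a ∈ ⨆ μ : K, (ad K L x).maxGenEigenspace μ := htop ▸ Submodule.mem_top
  have hb : b ∈ ⨆ μ : K, (ad K L x).maxGenEigenspace μ := htop ▸ Submodule.mem_top
  induction ha using Submodule.iSup_induction' with
  | zero => simp
  | add a₁ a₂ _ _ h₁ h₂ => simp only [add_lie, map_add, h₁, h₂]; abel
  | mem μ a ha =>
    induction hb using Submodule.iSup_induction' with
    | zero => simp
    | add b₁ b₂ _ _ h₁ h₂ => simp only [lie_add, map_add, h₁, h₂]; abel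
    | mem ν b hb =>
      rw [key μ a ha, key ν b hb, key (μ + ν) _ (LieModule.lie_mem_maxGenEigenspace_toEnd ha hb),
        smul_lie, lie_smul, add_smul]

variable [IsKilling K L]

theorem lie_eq_zero_of_commute_ad {x y : L} (h : Commute (ad K L x) (ad K L y)) : ⁅x, y⁆ = 0 := by
  rw [← LieSubmodule.mem_bot (R := K) (L := L), ← ad_ker_eq_bot_of_hasTrivialRadical K L,
    LieHom.mem_ker, LieHom.map_lie]
  exact h.lie_eq

/-- The abstract Jordan decomposition. -/
theorem exists_jordan_decomposition [CharZero K] [IsAlgClosed K] (x : L) : ∃ s n : L, x = s + n ∧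
    (ad K L s).IsSemisimple ∧ IsNilpotent (ad K L n) ∧ ⁅s, n⁆ = 0 ∧
    (∀ y : L, ⁅x, y⁆ = 0 → ⁅s, y⁆ = 0 ∧ ⁅n, y⁆ = 0) := by
  obtain ⟨n, hn, s, hs, hn', hs', hx⟩ := (ad K L x).exists_isNilpotent_isSemisimple
  have hcs : Commute (ad K L x) s :=
    (Algebra.commute_of_mem_adjoin_self hs)
  -- The semisimple part of ad x is a derivation, hence inner. It is also a polynomial in ad x, so
  -- it commutes with whatever ad x commutes with.
  let D : LieDerivation K L L :=
    { toLinearMap := s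
      leibniz' := fun a b => by
        rw [leibniz_of_commute_ad_of_isNilpotent hcs hs' (by rwa [hx, add_sub_cancel_right])]
        rw [← lie_skew (s a) b]
        abel }
  obtain ⟨s', hD⟩ := LieDerivation.IsKilling.exists_eq_ad D
  have hads : ad K L s' = s := by
    ext z
    rw [← LieDerivation.coe_ad_apply_eq_ad_apply, hD]
  have hadn : ad K L (x - s') = n := by rw [map_sub, hads, hx, add_sub_cancel_right]
  have hcomm : ∀ y : L, ⁅x, y⁆ = 0 → ⁅s', y⁆ = 0 := by
    intro y hy
    refine lie_eq_zero_of_commute_ad (K := K) ?_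
    rw [hads]
    refine (Algebra.commute_of_mem_adjoin_singleton_of_commute hs ?_).symm
    rw [commute_iff_lie_eq, ← LieHom.map_lie, ← lie_skew, hy, neg_zero, map_zero]
  have hsx : ⁅s', x⁆ = 0 := hcomm x (lie_self x)
  refine ⟨s', x - s', by abel, hads ▸ hs', hadn ▸ hn', ?_, fun y hy => ⟨hcomm y hy, ?_⟩⟩
  · rw [lie_sub, hsx, lie_self, sub_self]
  · rw [sub_lie, hy, hcomm y hy, sub_self]

end LieAlgebra

/-! ### Nondegeneracy of the Killing form on centralisers -/

namespace GyojaVinberg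

open LieAlgebra

variable {g : Type*} [LieRing g] [LieAlgebra ℂ g]

/-- The restriction of the Killing form of `g` to the subspace `U` is nondegenerate. -/
def KillingNondegenerateOn (U : Submodule ℂ g) : Prop :=
  ∀ x ∈ U, (∀ y ∈ U, killingForm ℂ g x y = 0) → x = 0

theorem mem_centralizer {X : Set g} {y : g} : y ∈ centralizer X ↔ ∀ x ∈ X, ⁅y, x⁆ = 0 := Iff.rfl

theorem lie_eq_zero_comm {L : Type*} [LieRing L] {x y : L} : ⁅x, y⁆ = 0 ↔ ⁅y, x⁆ = 0 := by
  rw [← lie_skew, neg_eq_zero]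

theorem centralizer_insert_toSubmodule (s : g) (X : Set g) :
    (centralizer (insert s X)).toSubmodule =
      (centralizer X).toSubmodule ⊓ LinearMap.ker (ad ℂ g s) := by
  ext x
  simp only [LieSubalgebra.mem_toSubmodule, mem_centralizer, Set.forall_mem_insert,
    Submodule.mem_inf, LinearMap.mem_ker, ad_apply, lie_eq_zero_comm (x := x) (y := s)]
  exact and_comm

theorem killingForm_eq_zero_of_isNilpotent_mul [FiniteDimensional ℂ g] {x y : g}
    (h : IsNilpotent (ad ℂ g x * ad ℂ g y)) : killingForm ℂ g x y = 0 := by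
  rw [killingForm_apply_apply]
  exact (LinearMap.isNilpotent_trace_of_isNilpotent h).eq_zero

theorem killingForm_eq_zero_of_lie_eq_zero [FiniteDimensional ℂ g] {x y : g} (hxy : ⁅x, y⁆ = 0)
    (hx : IsNilpotent (ad ℂ g x)) : killingForm ℂ g x y = 0 := by
  refine killingForm_eq_zero_of_isNilpotent_mul (Commute.isNilpotent_mul_right ?_ hx)
  rw [commute_iff_lie_eq, ← LieHom.map_lie, hxy, map_zero]

theorem killingForm_lie_eq_zero {x s : g} (h : ⁅x, s⁆ = 0) (c : g) :
    killingForm ℂ g x ⁅s, c⁆ = 0 := by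
  rw [← LieModule.traceForm_apply_lie_apply, h, map_zero, LinearMap.zero_apply]

theorem KillingNondegenerateOn.top [IsKilling ℂ g] :
    KillingNondegenerateOn (⊤ : Submodule ℂ g) := fun x _ hx =>
  (IsKilling.killingForm_nondegenerate ℂ g).1 x fun y => hx y Submodule.mem_top

/-- By hypothesis on s, U is the sum of the kernel and the image of ad s on U. A vector commuting
with s is orthogonal to the image by invariance, so being orthogonal to the kernel makes it
orthogonal to U. -/
theorem KillingNondegenerateOn.inf_ker_ad [FiniteDimensional ℂ g] {U : Submodule ℂ g}
    (hU : KillingNondegenerateOn U) {s : g} (hsU : ∀ x ∈ U, ⁅s, x⁆ ∈ U)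
    (hs : ∀ v : g, ⁅s, ⁅s, v⁆⁆ = 0 → ⁅s, v⁆ = 0) :
    KillingNondegenerateOn (U ⊓ LinearMap.ker (ad ℂ g s)) := by
  rintro x ⟨hxU, hxs⟩ hx
  replace hxs : ⁅x, s⁆ = 0 := lie_eq_zero_comm.mp hxs
  refine hU x hxU fun y hy => ?_
  have htop := LinearMap.codisjoint_ker_range_of_sq ((ad ℂ g s).restrict hsU)
    fun v hv => Subtype.ext (hs v (congrArg Subtype.val hv))
  have hy' : (⟨y, hy⟩ : U) ∈ LinearMap.ker ((ad ℂ g s).restrict hsU) ⊔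
      LinearMap.range ((ad ℂ g s).restrict hsU) := htop ▸ Submodule.mem_top
  obtain ⟨a, ha, _, ⟨c, rfl⟩, hab⟩ := Submodule.mem_sup.mp hy'
  have hyab : y = a + ⁅s, (c : g)⁆ := (congrArg Subtype.val hab).symm
  have ha0 : killingForm ℂ g x a = 0 := hx a ⟨a.2, congrArg Subtype.val ha⟩
  rw [hyab, map_add, ha0, killingForm_lie_eq_zero hxs, add_zero]

theorem KillingNondegenerateOn.centralizer_insert [FiniteDimensional ℂ g] {X : Set g} {s : g}
    (hX : KillingNondegenerateOn (centralizer X).toSubmodule) (hsX : s ∈ centralizer X)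
    (hs : ∀ v : g, ⁅s, ⁅s, v⁆⁆ = 0 → ⁅s, v⁆ = 0) :
    KillingNondegenerateOn (centralizer (insert s X)).toSubmodule := by
  rw [centralizer_insert_toSubmodule]
  exact hX.inf_ker_ad (fun x hx => (centralizer X).lie_mem hsX hx) hs

/-! ### Toral subalgebras -/

/-- The only consequence of semisimplicity needed for splitting kernel from image, and for
commutativity of toral subalgebras. -/
theorem IsToral.lie_lie_eq_zero {t : LieSubalgebra ℂ g} (ht : IsToral t) {s : g} (hs : s ∈ t)
    {v : g} (hv : ⁅s, ⁅s, v⁆⁆ = 0) : ⁅s, v⁆ = 0 :=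
  (ht s hs).apply_eq_zero_of_sq hv

theorem IsToral.lie_eq_zero [FiniteDimensional ℂ g] {t : LieSubalgebra ℂ g} (ht : IsToral t)
    {x y : g} (hx : x ∈ t) (hy : y ∈ t) : ⁅x, y⁆ = 0 := by
  have hst : ∀ z ∈ t.toSubmodule, ad ℂ g x z ∈ t.toSubmodule := fun z hz => t.lie_mem hx hz
  let T : Module.End ℂ t.toSubmodule := (ad ℂ g x).restrict hst
  have hss : T.IsSemisimple := (ht x hx).restrict hst
  have h0 : T = 0 := by
    -- If [x, z] = μ z with z in t, then [z, [z, x]] = 0, so semisimplicity of ad z forces μ z = 0.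
    rw [hss.eq_zero_iff_forall_eigenvalue]
    intro μ hμ
    obtain ⟨⟨z, hz⟩, hzμ, hz0⟩ := hμ.exists_hasEigenvector
    have h1 : ⁅x, z⁆ = μ • z := congrArg Subtype.val (Module.End.mem_eigenspace_iff.mp hzμ)
    have h2 : ⁅z, x⁆ = -(μ • z) := by rw [← h1, lie_skew]
    have h3 : ⁅z, x⁆ = 0 :=
      ht.lie_lie_eq_zero hz (by rw [h2, lie_neg, lie_smul, lie_self, smul_zero, neg_zero])
    rw [h2, neg_eq_zero, smul_eq_zero] at h3
    exact h3.resolve_right fun h => hz0 (Subtype.ext h)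
  exact congrArg Subtype.val (LinearMap.congr_fun h0 ⟨y, hy⟩)

/-- Adjoin the elements of a finite spanning set of t one at a time; since t is abelian, each lies
in the centraliser already reached. -/
theorem IsToral.killingNondegenerateOn_centralizer_union [FiniteDimensional ℂ g] {X : Set g}
    (hX : KillingNondegenerateOn (centralizer X).toSubmodule) {t : LieSubalgebra ℂ g}
    (ht : IsToral t) (htX : t ≤ centralizer X) :
    KillingNondegenerateOn (centralizer (X ∪ t)).toSubmodule := by
  have key : ∀ S : Finset g, (S : Set g) ⊆ t →
      KillingNondegenerateOn (centralizer (X ∪ S)).toSubmodule := by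
    classical
    intro S
    induction S using Finset.induction_on with
    | empty => intro _; simpa using hX
    | insert s S hsS ih =>
      intro hS
      rw [Finset.coe_insert, Set.insert_subset_iff] at hS
      rw [Finset.coe_insert, Set.union_insert]
      refine (ih hS.2).centralizer_insert ?_ fun v hv => ht.lie_lie_eq_zero hS.1 hv
      rintro x (hx | hx)
      · exact htX hS.1 x hx
      · exact ht.lie_eq_zero hS.1 (hS.2 hx)
  obtain ⟨S, hS⟩ := (IsNoetherian.noetherian t.toSubmodule : t.toSubmodule.FG)
  have hSt : (S : Set g) ⊆ t := fun s hs => by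
    rw [← LieSubalgebra.coe_toSubmodule, ← hS]; exact Submodule.subset_span hs
  convert key S hSt using 2
  refine le_antisymm (fun y hy x hx => hy x (Set.union_subset_union_right X hSt hx)) ?_
  rintro y hy x (hx | hx)
  · exact hy x (Or.inl hx)
  · have hle : t.toSubmodule ≤ LinearMap.ker (ad ℂ g y) := by
      rw [← hS, Submodule.span_le]
      exact fun s hs => hy s (Or.inr hs)
    exact hle hx

/-- A toral subalgebra together with a semisimple element commuting with it spans a toral
subalgebra. -/
theorem IsToral.exists_sup_span [FiniteDimensional ℂ g] {t : LieSubalgebra ℂ g} (ht : IsToral t)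
    {s : g} (hs : (ad ℂ g s).IsSemisimple) (hst : ∀ x ∈ t, ⁅s, x⁆ = 0) :
    ∃ t' : LieSubalgebra ℂ g, IsToral t' ∧ t'.toSubmodule = t.toSubmodule ⊔ Submodule.span ℂ {s} := by
  have hmem : ∀ x, x ∈ t.toSubmodule ⊔ Submodule.span ℂ {s} ↔ ∃ a ∈ t, ∃ c : ℂ, a + c • s = x := by
    intro x
    simp [Submodule.mem_sup, Submodule.mem_span_singleton]
  refine ⟨{ t.toSubmodule ⊔ Submodule.span ℂ {s} with lie_mem' := ?_ }, ?_, rfl⟩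
  · intro x y hx hy
    obtain ⟨a, ha, c, rfl⟩ := (hmem x).mp hx
    obtain ⟨b, hb, d, rfl⟩ := (hmem y).mp hy
    have h0 : ⁅a + c • s, b + d • s⁆ = 0 := by
      simp [ht.lie_eq_zero ha hb, hst b hb, lie_eq_zero_comm.mp (hst a ha)]
    rw [h0]
    exact Submodule.zero_mem _
  · intro x hx
    obtain ⟨a, ha, c, rfl⟩ := (hmem x).mp hx
    rw [map_add]
    refine Module.End.IsSemisimple.add_of_commute ?_ (ht a ha)
      (by rw [map_smul]; exact Module.End.IsSemisimple_smul c hs)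
    rw [commute_iff_lie_eq, ← LieHom.map_lie, lie_smul, lie_eq_zero_comm.mp (hst a ha), smul_zero,
      map_zero]

/-- A maximal toral subalgebra of the centraliser of `X` is its own centraliser there, if the
Killing form is nondegenerate on the centraliser of `X`. -/
theorem IsMaximalToralIn.mem_of_forall_lie_eq_zero [FiniteDimensional ℂ g] [IsKilling ℂ g]
    {X : Set g} (hX : KillingNondegenerateOn (centralizer X).toSubmodule) {t : LieSubalgebra ℂ g}
    (ht : IsMaximalToralIn (centralizer X) t) {y : g} (hyX : ∀ x ∈ X, ⁅y, x⁆ = 0)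
    (hyt : ∀ s ∈ t, ⁅y, s⁆ = 0) : y ∈ t := by
  set m := centralizer (X ∪ (t : Set g))
  have hm : KillingNondegenerateOn m.toSubmodule :=
    ht.prop.2.killingNondegenerateOn_centralizer_union hX ht.prop.1
  -- The semisimple part of y commutes with X and with t, so t together with it spans a toral
  -- subalgebra of the centraliser of X; maximality puts it in t.
  have hjord : ∀ y ∈ m, ∃ s ∈ t, ∃ n ∈ m, y = s + n ∧ IsNilpotent (ad ℂ g n) := by
    intro y hy
    obtain ⟨s, n, hsn, hs, hn, -, hcomm⟩ := exists_jordan_decomposition (K := ℂ) y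
    refine ⟨s, ?_, n, fun x hx => (hcomm x (hy x hx)).2, hsn, hn⟩
    obtain ⟨t', ht', htt'⟩ := ht.prop.2.exists_sup_span hs
      fun x hx => (hcomm x (hy x (Or.inr hx))).1
    have hle : t ≤ t' := by
      rw [← LieSubalgebra.toSubmodule_le_toSubmodule, htt']
      exact le_sup_left
    have hle' : t' ≤ centralizer X := by
      rw [← LieSubalgebra.toSubmodule_le_toSubmodule, htt']
      refine sup_le (fun a ha => ht.prop.1 ha) ?_
      rw [Submodule.span_singleton_le_iff_mem]
      exact fun x hx => (hcomm x (hy x (Or.inl hx))).1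
    refine ht.le_of_ge ⟨hle', ht'⟩ hle ?_
    rw [← LieSubalgebra.mem_toSubmodule, htt']
    exact Submodule.mem_sup_right (Submodule.mem_span_singleton_self s)
  -- On m the summand s ∈ t acts as zero, so every ad y is nilpotent on m, and Engel's theorem
  -- applies.
  have hnil : LieRing.IsNilpotent m := by
    rw [LieAlgebra.isNilpotent_iff_forall (R := ℂ)]
    rintro ⟨y, hy⟩
    obtain ⟨s, hs, n, hn, rfl, hn'⟩ := hjord y hy
    have : ad ℂ m ⟨s + n, hy⟩ = ad ℂ m ⟨n, hn⟩ := by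
      ext z
      change ⁅s + n, (z : g)⁆ = ⁅n, (z : g)⁆
      rw [add_lie, lie_eq_zero_comm.mp (z.2 s (Or.inr hs)), zero_add]
    rw [this]
    exact LieSubalgebra.isNilpotent_ad_of_isNilpotent_ad m hn'
  have hym : y ∈ m := by
    rintro x (hx | hx)
    · exact hyX x hx
    · exact hyt x hx
  obtain ⟨s, hs, n, hn, rfl, hn'⟩ := hjord y hym
  -- As m is solvable, it is its own radical, so n is orthogonal to all of m.
  have hn0 : n = 0 := by
    refine hm n hn fun z hz => killingForm_eq_zero_of_isNilpotent_mul ?_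
    have hrad : (⟨n, hn⟩ : m) ∈ radical ℂ m := by
      rw [LieAlgebra.radical_eq_top_of_isSolvable]
      exact LieSubmodule.mem_top _
    exact LieModule.isNilpotent_toEnd_mul_of_mem_radical (V := g) hrad (Or.inr hn') ⟨z, hz⟩
  rwa [hn0, add_zero]

/-! ### Centralisers as ambient algebras -/

theorem isSemisimple_ad_of_mem {C : LieSubalgebra ℂ g} {x : C}
    (hx : (ad ℂ g (x : g)).IsSemisimple) : (ad ℂ C x).IsSemisimple :=
  Module.End.IsSemisimple.restrict (f := ad ℂ g (x : g)) (p := C.toSubmodule)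
    (fun _ hy => C.lie_mem x.2 hy) hx

/-- The Jordan parts s, n of x in g stay in the centraliser C. If x is semisimple on C, uniqueness
of the decomposition makes n central in C; being ad-nilpotent, it is orthogonal to C, hence zero. -/
theorem isSemisimple_ad_iff_of_centralizer [FiniteDimensional ℂ g] [IsKilling ℂ g] {X : Set g}
    {C : LieSubalgebra ℂ g} (hC : C = centralizer X) (hn : KillingNondegenerateOn C.toSubmodule)
    (x : C) : (ad ℂ C x).IsSemisimple ↔ (ad ℂ g (x : g)).IsSemisimple := by
  refine ⟨fun hx => ?_, isSemisimple_ad_of_mem⟩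
  obtain ⟨s, n, hsn, hs, hn', -, hcomm⟩ := exists_jordan_decomposition (K := ℂ) (x : g)
  have hxX : ∀ y ∈ X, ⁅(x : g), y⁆ = 0 := hC.le x.2
  have hsC : s ∈ C := by rw [hC]; exact fun y hy => (hcomm y (hxX y hy)).1
  have hnC : n ∈ C := by rw [hC]; exact fun y hy => (hcomm y (hxX y hy)).2
  have hxs : x = ⟨n, hnC⟩ + ⟨s, hsC⟩ := Subtype.ext (hsn.trans (add_comm s n))
  have hnx : ⁅n, (x : g)⁆ = 0 := (hcomm x (lie_self _)).2
  have hns : ⁅n, s⁆ = 0 := by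
    rwa [hsn, lie_add, lie_self, add_zero] at hnx
  have h1 := Module.End.isNilpotent_isSemisimple_unique (K := ℂ) (V := C)
    (n₁ := ad ℂ C ⟨n, hnC⟩) (s₁ := ad ℂ C ⟨s, hsC⟩) (n₂ := 0) (s₂ := ad ℂ C x)
    (LieSubalgebra.isNilpotent_ad_of_isNilpotent_ad C hn') (isSemisimple_ad_of_mem hs)
    IsNilpotent.zero hx
    (by
      rw [commute_iff_lie_eq, ← LieHom.map_lie, show ⁅(⟨n, hnC⟩ : C), (⟨s, hsC⟩ : C)⁆ = 0 from
        Subtype.ext hns, map_zero])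
    (Commute.zero_left _) (by rw [zero_add, ← map_add, ← hxs])
  have hn0 : n = 0 := by
    refine hn n hnC fun y hy => killingForm_eq_zero_of_lie_eq_zero ?_ hn'
    exact congrArg Subtype.val (LinearMap.congr_fun h1.1 ⟨y, hy⟩)
  rwa [hsn, hn0, add_zero]

/-- A bracket [l, r] with r in the radical is orthogonal to C, so it vanishes. -/
theorem hasCentralRadical_of_killingNondegenerateOn [FiniteDimensional ℂ g]
    {C : LieSubalgebra ℂ g} (hn : KillingNondegenerateOn C.toSubmodule) :
    HasCentralRadical ℂ C := by
  refine hasCentralRadical_of_radical_le ℂ C fun r hr => ?_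
  rw [LieModule.mem_maxTrivSubmodule]
  intro l
  refine Subtype.ext (hn _ ⁅l, r⁆.2 fun y hy => killingForm_eq_zero_of_isNilpotent_mul ?_)
  exact LieModule.isNilpotent_toEnd_mul_of_mem_radical (V := g)
    (x := ⁅l, r⁆) (lie_mem_right ℂ C (radical ℂ C) l r hr) (Or.inl ⟨l, r, hr, rfl⟩) ⟨y, hy⟩

end GyojaVinberg

/-! ### The grading of an `sl₂`-triple and its centraliser -/

namespace GyojaVinberg

open LieAlgebra

variable {g : Type*} [LieRing g] [LieAlgebra ℂ g] {h e f : g}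

theorem mem_gr_iff {k : ℤ} {x : g} : x ∈ gr h k ↔ ⁅h, x⁆ = (2 * k : ℂ) • x := by
  rw [mem_gr, smul_lie, inv_smul_eq_iff₀ two_ne_zero, smul_smul]

theorem mem_gr0_iff {x : g} : x ∈ gr0 h ↔ ⁅h, x⁆ = 0 := by
  change x ∈ gr h 0 ↔ _
  simp [mem_gr_iff]

theorem mem_gr1_iff {x : g} : x ∈ gr1 h ↔ ⁅h, x⁆ = (2 : ℂ) • x := by
  change x ∈ gr h 1 ↔ _
  simp [mem_gr_iff]

theorem gr0_eq_centralizer (h : g) : gr0 h = centralizer {h} := by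
  ext x
  rw [mem_gr0_iff, lie_eq_zero_comm]
  simp [mem_centralizer]

theorem mem_centralizer_triple {x : g} :
    x ∈ centralizer {h, e, f} ↔ ⁅h, x⁆ = 0 ∧ ⁅e, x⁆ = 0 ∧ ⁅f, x⁆ = 0 := by
  simp [mem_centralizer, lie_eq_zero_comm (x := x)]

theorem centralizer_triple_le_gr0 : centralizer {h, e, f} ≤ gr0 h := fun _ hx =>
  mem_gr0_iff.mpr (mem_centralizer_triple.mp hx).1

theorem killingNondegenerateOn_gr0 [FiniteDimensional ℂ g] [IsKilling ℂ g]
    (hnil : IsNilpotent (ad ℂ g e)) (hs : IsSl2Triple h e f) :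
    KillingNondegenerateOn (gr0 h).toSubmodule := by
  have h1 : KillingNondegenerateOn (centralizer (∅ : Set g)).toSubmodule := by
    convert KillingNondegenerateOn.top (g := g) using 1
    ext x
    simp [mem_centralizer]
  rw [gr0_eq_centralizer, ← insert_empty_eq]
  exact h1.centralizer_insert (by simp [mem_centralizer])
    fun v hv => hs.lie_h_eq_zero_of_lie_h_lie_h_eq_zero (K := ℂ) hnil hv

theorem killingNondegenerateOn_centralizer_triple [FiniteDimensional ℂ g] [IsKilling ℂ g]
    (hnil : IsNilpotent (ad ℂ g e)) (hs : IsSl2Triple h e f) :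
    KillingNondegenerateOn (centralizer {h, e, f}).toSubmodule := by
  intro x hx hxy
  refine killingNondegenerateOn_gr0 hnil hs x (centralizer_triple_le_gr0 hx) fun y hy => ?_
  have hy0 : ⁅h, y⁆ = ((0 : ℕ) : ℂ) • y := by simpa using mem_gr0_iff.mp hy
  -- Decompose g_0 as z + [f, g_1]; an element of z commutes with f and so is orthogonal to the
  -- second term.
  obtain ⟨u, w, rfl, hu, heu, -⟩ := hs.exists_eq_add_lie_f hy0
  have hfu := hs.lie_f_eq_zero (K := ℂ) (by simpa using hu) heu
  rw [map_add, hxy u (mem_centralizer_triple.mpr ⟨by simpa using hu, heu, hfu⟩),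
    killingForm_lie_eq_zero (hx f (by simp)), add_zero]

theorem mem_stabilizer_iff [FiniteDimensional ℂ g] (hs : IsSl2Triple h e f) (x : gr0 h) :
    x ∈ stabilizer (gr0 h) (⟨e, e_mem_gr1 hs⟩ : gr1 h) ↔ (x : g) ∈ centralizer {h, e, f} := by
  have h1 : x ∈ stabilizer (gr0 h) (⟨e, e_mem_gr1 hs⟩ : gr1 h) ↔ ⁅(x : g), e⁆ = 0 :=
    ⟨fun hx => congrArg Subtype.val hx, fun hx => Subtype.ext hx⟩
  have h2 := mem_gr0_iff.mp x.2
  rw [h1, mem_centralizer_triple]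
  refine ⟨fun hx => ?_, fun hx => lie_eq_zero_comm.mp hx.2.1⟩
  have h3 := lie_eq_zero_comm.mp hx
  exact ⟨h2, h3, hs.lie_f_eq_zero (K := ℂ) (by simpa using h2) h3⟩

theorem isToral_map_incl_iff [FiniteDimensional ℂ g] [IsKilling ℂ g]
    (hnil : IsNilpotent (ad ℂ g e)) (hs : IsSl2Triple h e f) (u : LieSubalgebra ℂ (gr0 h)) :
    IsToral (u.map (gr0 h).incl) ↔ IsToral u := by
  have hiff := isSemisimple_ad_iff_of_centralizer (gr0_eq_centralizer h)
    (killingNondegenerateOn_gr0 hnil hs)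
  refine ⟨fun hu x hx => (hiff x).mpr (hu x ⟨x, hx, rfl⟩), ?_⟩
  rintro hu _ ⟨x, hx, rfl⟩
  exact (hiff x).mp (hu x hx)

theorem map_incl_le_iff [FiniteDimensional ℂ g] (hs : IsSl2Triple h e f)
    (u : LieSubalgebra ℂ (gr0 h)) : u.map (gr0 h).incl ≤ centralizer {h, e, f} ↔
      u ≤ stabilizer (gr0 h) (⟨e, e_mem_gr1 hs⟩ : gr1 h) := by
  refine ⟨fun hu x hx => (mem_stabilizer_iff hs x).mpr (hu ⟨x, hx, rfl⟩), ?_⟩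
  rintro hu _ ⟨x, hx, rfl⟩
  exact (mem_stabilizer_iff hs x).mp (hu hx)

theorem map_comap_incl {L : Type*} [LieRing L] [LieAlgebra ℂ L] {C u : LieSubalgebra ℂ L}
    (hu : u ≤ C) : (u.comap C.incl).map C.incl = u := by
  ext x
  refine ⟨?_, fun hx => ⟨⟨x, hu hx⟩, hx, rfl⟩⟩
  rintro ⟨y, hy, rfl⟩
  exact hy

theorem map_incl_le_map_incl {L : Type*} [LieRing L] [LieAlgebra ℂ L] {C : LieSubalgebra ℂ L}
    {u v : LieSubalgebra ℂ C} : u.map C.incl ≤ v.map C.incl ↔ u ≤ v := by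
  refine ⟨fun huv x hx => ?_, ?_⟩
  · obtain ⟨y, hy, hyx⟩ := huv ⟨x, hx, rfl⟩
    rwa [← Subtype.ext (a1 := y) (a2 := x) hyx]
  · rintro huv _ ⟨x, hx, rfl⟩
    exact ⟨x, huv hx, rfl⟩

theorem isMaximalToralIn_map_incl_iff [FiniteDimensional ℂ g] [IsKilling ℂ g]
    (hnil : IsNilpotent (ad ℂ g e)) (hs : IsSl2Triple h e f) (t : LieSubalgebra ℂ (gr0 h)) :
    IsMaximalToralIn (centralizer {h, e, f}) (t.map (gr0 h).incl) ↔
      IsMaximalToralIn (stabilizer (gr0 h) (⟨e, e_mem_gr1 hs⟩ : gr1 h)) t := by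
  constructor
  · intro ht
    refine ⟨⟨(map_incl_le_iff hs t).mp ht.prop.1, (isToral_map_incl_iff hnil hs t).mp ht.prop.2⟩,
      fun u hu htu => map_incl_le_map_incl.mp (ht.le_of_ge ?_ (map_incl_le_map_incl.mpr htu))⟩
    exact ⟨(map_incl_le_iff hs u).mpr hu.1, (isToral_map_incl_iff hnil hs u).mpr hu.2⟩
  · intro ht
    refine ⟨⟨(map_incl_le_iff hs t).mpr ht.prop.1, (isToral_map_incl_iff hnil hs t).mpr ht.prop.2⟩,
      fun u hu htu => ?_⟩
    have hmap := map_comap_incl (hu.1.trans centralizer_triple_le_gr0)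
    rw [← hmap] at hu htu ⊢
    exact map_incl_le_map_incl.mpr (ht.le_of_ge ⟨(map_incl_le_iff hs _).mp hu.1,
      (isToral_map_incl_iff hnil hs _).mp hu.2⟩ (map_incl_le_map_incl.mp htu))

/-! ### The carrier algebra -/

section Carrier

variable {t : LieSubalgebra ℂ g}

/-- Here λ vanishes on t and λ(h) = 2, so the condition for h merely repeats the degree and only
invariance under t remains. -/
theorem mem_vinbergPiece_iff (hs : IsSl2Triple h e f) (ht : t ≤ centralizer {h, e, f}) {k : ℤ}
    {x : g} : x ∈ vinbergPiece h e t k ↔ x ∈ gr h k ∧ ∀ s ∈ t, ⁅s, x⁆ = 0 := by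
  refine ⟨fun hx => ⟨hx.1, fun s hst => ?_⟩, fun hx => ⟨hx.1, fun s hst c hc => ?_⟩⟩
  · have := hx.2 s (Submodule.mem_sup_right hst) 0 (by rw [zero_smul]; exact ht hst e (by simp))
    rwa [mul_zero, zero_smul] at this
  · obtain ⟨a, ha, b, hb, rfl⟩ := Submodule.mem_sup.mp hst
    obtain ⟨r, rfl⟩ := Submodule.mem_span_singleton.mp ha
    have hc' : ⁅r • h + b, e⁆ = (r * 2) • e := by
      rw [add_lie, ht hb e (by simp), smul_lie, hs.lie_h_e_smul ℂ, smul_smul, add_zero]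
    obtain rfl : c = r * 2 := smul_left_injective ℂ hs.e_ne_zero (hc.symm.trans hc')
    rw [add_lie, hx.2 b hb, smul_lie, mem_gr_iff.mp hx.1, smul_smul, add_zero]
    congr 1
    ring

theorem lie_mem_carrierAlgebra {k l : ℤ} {x y : g} (hx : x ∈ vinbergPiece h e t k)
    (hy : y ∈ vinbergPiece h e t l) : ⁅x, y⁆ ∈ carrierAlgebra h e t := by
  have hx' : x ∈ vinbergAlgebra h e t := Submodule.mem_iSup_of_mem k hx
  have hy' : y ∈ vinbergAlgebra h e t := Submodule.mem_iSup_of_mem l hy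
  refine ⟨⁅(⟨x, hx'⟩ : vinbergAlgebra h e t), ⟨y, hy'⟩⁆, ?_, rfl⟩
  exact LieSubmodule.lie_mem_lie (LieSubmodule.mem_top _) (LieSubmodule.mem_top _)

theorem lie_eq_zero_of_mem_vinbergAlgebra (hs : IsSl2Triple h e f)
    (ht : t ≤ centralizer {h, e, f}) {x : g} (hx : x ∈ vinbergAlgebra h e t) {s : g} (hst : s ∈ t) :
    ⁅s, x⁆ = 0 := by
  have hle : (⨆ k : ℤ, vinbergPiece h e t k) ≤ LinearMap.ker (ad ℂ g s) :=
    iSup_le fun k y hy => ((mem_vinbergPiece_iff hs ht).mp hy).2 s hst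
  exact hle hx

theorem lie_eq_zero_of_mem_carrierAlgebra (hs : IsSl2Triple h e f)
    (ht : t ≤ centralizer {h, e, f}) {x : g} (hx : x ∈ carrierAlgebra h e t) {s : g}
    (hst : s ∈ t) : ⁅s, x⁆ = 0 := by
  obtain ⟨y, -, rfl⟩ := hx
  exact lie_eq_zero_of_mem_vinbergAlgebra hs ht y.2 hst

theorem killingForm_eq_zero_of_mem_carrierAlgebra (hs : IsSl2Triple h e f)
    (ht : t ≤ centralizer {h, e, f}) {x : g} (hx : x ∈ carrierAlgebra h e t) {s : g}
    (hst : s ∈ t) : killingForm ℂ g s x = 0 := by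
  obtain ⟨y, hy, rfl⟩ := hx
  have hy' : y ∈ (⁅(⊤ : LieIdeal ℂ (vinbergAlgebra h e t)), (⊤ : LieIdeal ℂ _)⁆ : LieIdeal ℂ _) := hy
  rw [← LieSubmodule.mem_toSubmodule, LieSubmodule.lieIdeal_oper_eq_linear_span'] at hy'
  have hle : Submodule.span ℂ {⁅a, b⁆ | (a ∈ (⊤ : LieIdeal ℂ (vinbergAlgebra h e t)))
      (b ∈ (⊤ : LieIdeal ℂ (vinbergAlgebra h e t)))} ≤
      LinearMap.ker (killingForm ℂ g s ∘ₗ (vinbergAlgebra h e t).toSubmodule.subtype) := by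
    rw [Submodule.span_le]
    rintro _ ⟨a, -, b, -, rfl⟩
    exact killingForm_lie_eq_zero (lie_eq_zero_of_mem_vinbergAlgebra hs ht a.2 hst) _
  exact hle hy'

theorem mem_carrierAlgebra_of_mem_gr1 (hs : IsSl2Triple h e f) (ht : t ≤ centralizer {h, e, f})
    {w : g} (hw : w ∈ gr1 h) (hwt : ∀ s ∈ t, ⁅s, w⁆ = 0) : w ∈ carrierAlgebra h e t := by
  have h1 : w ∈ vinbergPiece h e t 1 := (mem_vinbergPiece_iff hs ht).mpr ⟨hw, hwt⟩
  have h0 : (2⁻¹ : ℂ) • h ∈ vinbergPiece h e t 0 := by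
    refine (mem_vinbergPiece_iff hs ht).mpr ⟨?_, fun s hst => ?_⟩
    -- The element h/2 lies in degree 0 of g(t,e) and acts on w as 1, so w = [h/2, w] is a
    -- commutator.
    · simp [mem_gr]
    · rw [lie_smul, ht hst h (by simp), smul_zero]
  have h2 := lie_mem_carrierAlgebra h0 h1
  rw [mem_gr.mp h1.1] at h2
  simpa using h2

/-- Allows the sl₂ lemmas to be applied to the centraliser of t, so that the vectors they produce
commute with t. -/
theorem exists_isSl2Triple_centralizer (hs : IsSl2Triple h e f) (ht : t ≤ centralizer {h, e, f}) :
    ∃ h' e' f' : centralizer (t : Set g), IsSl2Triple h' e' f' ∧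
      (h' : g) = h ∧ (e' : g) = e ∧ (f' : g) = f := by
  have hmem : ∀ x ∈ ({h, e, f} : Set g), x ∈ centralizer (t : Set g) := fun x hx s hst =>
    lie_eq_zero_comm.mp (ht hst x hx)
  refine ⟨⟨h, hmem h (by simp)⟩, ⟨e, hmem e (by simp)⟩, ⟨f, hmem f (by simp)⟩, ?_, rfl, rfl, rfl⟩
  exact ⟨fun h0 => hs.h_ne_zero (congrArg Subtype.val h0), Subtype.ext hs.lie_e_f,
    Subtype.ext hs.lie_h_e_nsmul, Subtype.ext hs.lie_h_f_nsmul⟩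

variable [FiniteDimensional ℂ g]

theorem exists_lie_e_eq_of_mem_gr1 (hs : IsSl2Triple h e f) (ht : t ≤ centralizer {h, e, f})
    {w : g} (hw : w ∈ gr1 h) (hwt : ∀ s ∈ t, ⁅s, w⁆ = 0) :
    ∃ x ∈ gr0 h, (∀ s ∈ t, ⁅s, x⁆ = 0) ∧ ⁅e, x⁆ = w := by
  obtain ⟨h', e', f', hs', rfl, rfl, rfl⟩ := exists_isSl2Triple_centralizer hs ht
  have hw' : ⁅h', (⟨w, fun s hst => lie_eq_zero_comm.mp (hwt s hst)⟩ : centralizer (t : Set g))⁆ =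
      (2 : ℂ) • ⟨w, fun s hst => lie_eq_zero_comm.mp (hwt s hst)⟩ :=
    Subtype.ext (mem_gr1_iff.mp hw)
  obtain ⟨x, hx, hx'⟩ := hs'.exists_lie_e_eq hw'
  exact ⟨x, mem_gr0_iff.mpr (congrArg Subtype.val hx),
    fun s hst => lie_eq_zero_comm.mp (x.2 s hst), congrArg Subtype.val hx'⟩

variable [IsKilling ℂ g]

theorem mem_of_mem_centralizer_triple (hnil : IsNilpotent (ad ℂ g e)) (hs : IsSl2Triple h e f)
    (ht : IsMaximalToralIn (centralizer {h, e, f}) t) {x : g} (hx0 : ⁅h, x⁆ = 0)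
    (hxe : ⁅e, x⁆ = 0) (hxt : ∀ s ∈ t, ⁅s, x⁆ = 0) : x ∈ t :=
  ht.mem_of_forall_lie_eq_zero (killingNondegenerateOn_centralizer_triple hnil hs)
    (mem_centralizer_triple.mpr
      ⟨hx0, hxe, hs.lie_f_eq_zero (K := ℂ) (by simpa using hx0) hxe⟩)
    fun s hst => lie_eq_zero_comm.mp (hxt s hst)

/-- The Killing form is nondegenerate on the centraliser of the triple and t, which is t itself,
while commutators in g(t,e) are orthogonal to t. -/
theorem eq_zero_of_mem_carrierAlgebra_of_mem (hnil : IsNilpotent (ad ℂ g e))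
    (hs : IsSl2Triple h e f) (ht : IsMaximalToralIn (centralizer {h, e, f}) t) {x : g}
    (hx : x ∈ carrierAlgebra h e t) (hxt : x ∈ t) : x = 0 := by
  refine ht.prop.2.killingNondegenerateOn_centralizer_union
    (killingNondegenerateOn_centralizer_triple hnil hs) ht.prop.1 x ?_ fun y hy => ?_
  · rintro y (hy | hy)
    · exact ht.prop.1 hxt y hy
    · exact ht.prop.2.lie_eq_zero hxt hy
  · rw [LieModule.traceForm_comm]
    refine killingForm_eq_zero_of_mem_carrierAlgebra hs ht.prop.1 hx ?_
    exact ht.mem_of_forall_lie_eq_zero (killingNondegenerateOn_centralizer_triple hnil hs)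
      (fun z hz => hy z (Or.inl hz)) fun z hz => hy z (Or.inr hz)

/-- In the centraliser of t, split x as u + [f, w] with e u = 0. Then u centralises the triple and
t, so u ∈ t, and [f, w] is a commutator of elements of g(t,e) of degrees -1 and 1. -/
theorem exists_eq_add_mem_carrier0 (hnil : IsNilpotent (ad ℂ g e)) (hs : IsSl2Triple h e f)
    (ht : IsMaximalToralIn (centralizer {h, e, f}) t) {x : g} (hx : x ∈ gr0 h)
    (hxt : ∀ s ∈ t, ⁅s, x⁆ = 0) : ∃ s ∈ t, ∃ c ∈ carrier0 h e t, x = s + c := by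
  obtain ⟨h', e', f', hs', hh, he, hf⟩ := exists_isSl2Triple_centralizer hs ht.prop.1
  have hx' : ⁅h', (⟨x, fun s hst => lie_eq_zero_comm.mp (hxt s hst)⟩ : centralizer (t : Set g))⁆ =
      ((0 : ℕ) : ℂ) • ⟨x, fun s hst => lie_eq_zero_comm.mp (hxt s hst)⟩ := by
    rw [Nat.cast_zero, zero_smul]
    refine Subtype.ext ?_
    change ⁅(h' : g), x⁆ = 0
    rw [hh]
    exact mem_gr0_iff.mp hx
  obtain ⟨u, w, hxu, hu, heu, hw⟩ := hs'.exists_eq_add_lie_f hx'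
  have hxu' : x = u + ⁅f, (w : g)⁆ := hf ▸ congrArg Subtype.val hxu
  rw [Nat.cast_zero, zero_smul] at hu
  have hu' : ⁅h, (u : g)⁆ = 0 := hh ▸ congrArg Subtype.val hu
  have hut : (u : g) ∈ t := mem_of_mem_centralizer_triple hnil hs ht hu'
    (he ▸ congrArg Subtype.val heu) fun s hst => lie_eq_zero_comm.mp (u.2 s hst)
  rw [Nat.cast_zero, zero_add] at hw
  have hw1 : (w : g) ∈ vinbergPiece h e t 1 := (mem_vinbergPiece_iff hs ht.prop.1).mpr
    ⟨mem_gr1_iff.mpr (hh ▸ congrArg Subtype.val hw), fun s hst => lie_eq_zero_comm.mp (w.2 s hst)⟩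
  have hf1 : f ∈ vinbergPiece h e t (-1) := by
    refine (mem_vinbergPiece_iff hs ht.prop.1).mpr ⟨?_, fun s hst => ht.prop.1 hst f (by simp)⟩
    rw [mem_gr_iff, hs.lie_lie_smul_f ℂ]
    simp
  refine ⟨u, hut, ⁅f, (w : g)⁆, ⟨lie_mem_carrierAlgebra hf1 hw1, ?_⟩, hxu'⟩
  exact (by simpa using lie_mem_gr hf1.1 hw1.1 : ⁅f, (w : g)⁆ ∈ gr h 0)

end Carrier

end GyojaVinberg

/-! ### Comparison of the two constructions -/

namespace GyojaVinberg

open LieAlgebra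

/-- If x normalises t and s ∈ t, then [s, x] ∈ t commutes with s, so [s, [s, x]] = 0 and
semisimplicity gives [s, x] = 0. -/
theorem IsToral.normalizer_eq_centralizer {L : Type*} [LieRing L] [LieAlgebra ℂ L]
    [FiniteDimensional ℂ L] {t : LieSubalgebra ℂ L} (ht : IsToral t) :
    t.normalizer = centralizer (t : Set L) := by
  ext x
  rw [LieSubalgebra.mem_normalizer_iff', mem_centralizer]
  refine ⟨fun hx s hst => ?_, fun hx s hst => ?_⟩
  · exact lie_eq_zero_comm.mp (ht.lie_lie_eq_zero hst (ht.lie_eq_zero hst (hx s hst)))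
  · rw [lie_eq_zero_comm.mp (hx s hst)]
    exact t.zero_mem

variable {g : Type*} [LieRing g] [LieAlgebra ℂ g] {h e f : g}

theorem isGeneric_gr1 [FiniteDimensional ℂ g] (hs : IsSl2Triple h e f) :
    IsGeneric (gr0 h) (⟨e, e_mem_gr1 hs⟩ : gr1 h) := by
  rintro ⟨w, hw⟩
  obtain ⟨x, hx, hxe⟩ := hs.exists_lie_e_eq (mem_gr1_iff.mp hw)
  refine ⟨⟨-x, neg_mem (mem_gr0_iff.mpr hx)⟩, Subtype.ext ?_⟩
  change ⁅-x, e⁆ = w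
  rw [neg_lie, lie_skew, hxe]

variable {t : LieSubalgebra ℂ (gr0 h)}

/-- `V^t` and `c(e)_1` are the same subspace of `g`. -/
def fixedPointsEquiv (hs : IsSl2Triple h e f)
    (ht : t.map (gr0 h).incl ≤ centralizer {h, e, f}) :
    fixedPoints (gr1 h) t ≃ₗ[ℂ] carrier1 h e (t.map (gr0 h).incl) where
  toFun v := ⟨((v : gr1 h) : g), mem_carrierAlgebra_of_mem_gr1 hs ht (v : gr1 h).2 (by
    rintro _ ⟨s, hst, rfl⟩
    exact congrArg Subtype.val (v.2 s hst)), (v : gr1 h).2⟩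
  invFun w := ⟨⟨w, w.2.2⟩, fun s hst =>
    Subtype.ext (lie_eq_zero_of_mem_carrierAlgebra hs ht w.2.1 ⟨s, hst, rfl⟩)⟩
  map_add' _ _ := rfl
  map_smul' _ _ := rfl
  left_inv _ := rfl
  right_inv _ := rfl

/-- The inclusion of `c(e)_0` in the normaliser of `t`. -/
def carrier0ToNormalizer (hs : IsSl2Triple h e f)
    (ht : t.map (gr0 h).incl ≤ centralizer {h, e, f}) :
    carrier0 h e (t.map (gr0 h).incl) →ₗ⁅ℂ⁆ t.normalizer where
  toFun c := ⟨⟨c, c.2.2⟩, (LieSubalgebra.mem_normalizer_iff' t _).mpr fun s hst => by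
    rw [show ⁅s, (⟨c, c.2.2⟩ : gr0 h)⁆ = 0 from
      Subtype.ext (lie_eq_zero_of_mem_carrierAlgebra hs ht c.2.1 ⟨s, hst, rfl⟩)]
    exact t.zero_mem⟩
  map_add' _ _ := rfl
  map_smul' _ _ := rfl
  map_lie' := rfl

variable [FiniteDimensional ℂ g] [IsKilling ℂ g]

/-- Injectivity is c(e) ∩ t = 0; surjectivity is the decomposition of the centraliser of t in g_0 as
t + c(e)_0. -/
theorem bijective_mk_carrier0ToNormalizer (hnil : IsNilpotent (ad ℂ g e)) (hs : IsSl2Triple h e f)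
    (ht : IsMaximalToralIn (centralizer {h, e, f}) (t.map (gr0 h).incl)) :
    Function.Bijective ((LieSubmodule.Quotient.mk' (torusIdeal t) : t.normalizer → _) ∘
      carrier0ToNormalizer hs ht.prop.1) := by
  have htt : IsToral t :=
    ((isMaximalToralIn_map_incl_iff hnil hs t).mp ht).prop.2
  have hmk : ∀ x y : t.normalizer, LieSubmodule.Quotient.mk' (torusIdeal t) x =
      LieSubmodule.Quotient.mk' (torusIdeal t) y ↔ (x : gr0 h) - y ∈ t := fun x y =>
    Submodule.Quotient.eq (torusIdeal t).toSubmodule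
  constructor
  · intro c d hcd
    refine Subtype.ext (sub_eq_zero.mp ?_)
    refine eq_zero_of_mem_carrierAlgebra_of_mem hnil hs ht (sub_mem c.2.1 d.2.1) ?_
    exact ⟨_, (hmk _ _).mp hcd, rfl⟩
  · intro x
    obtain ⟨x, rfl⟩ := LieSubmodule.Quotient.surjective_mk' _ x
    have hx : (x : gr0 h) ∈ centralizer (t : Set (gr0 h)) := htt.normalizer_eq_centralizer ▸ x.2
    obtain ⟨s, ⟨s', hs', rfl⟩, c, hc, hxsc⟩ := exists_eq_add_mem_carrier0 hnil hs ht
      (x := ((x : gr0 h) : g)) (x : gr0 h).2 (by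
        rintro _ ⟨s, hst, rfl⟩
        exact lie_eq_zero_comm.mp (congrArg Subtype.val (hx s hst)))
    refine ⟨⟨c, hc⟩, (hmk _ _).mpr ?_⟩
    have : ((carrier0ToNormalizer hs ht.prop.1 ⟨c, hc⟩ : t.normalizer) : gr0 h) - x = -s' := by
      refine Subtype.ext ?_
      change c - ((x : gr0 h) : g) = -(s' : g)
      rw [hxsc]
      change c - ((s' : g) + c) = -(s' : g)
      abel
    rw [this]
    exact neg_mem hs'

/-- The isomorphism `n(t) / t ≃ c(e)_0` inverse to the map induced by the inclusion. -/
noncomputable def gyojaEquiv (hnil : IsNilpotent (ad ℂ g e)) (hs : IsSl2Triple h e f)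
    (ht : IsMaximalToralIn (centralizer {h, e, f}) (t.map (gr0 h).incl)) :
    GyojaAlgebra t ≃ₗ⁅ℂ⁆ carrier0 h e (t.map (gr0 h).incl) :=
  (LieEquiv.ofBijective
    ({ (LieSubmodule.Quotient.mk' (torusIdeal t) : t.normalizer →ₗ[ℂ] GyojaAlgebra t) ∘ₗ
        (carrier0ToNormalizer hs ht.prop.1 : _ →ₗ[ℂ] t.normalizer) with
      map_lie' := rfl } : carrier0 h e (t.map (gr0 h).incl) →ₗ⁅ℂ⁆ GyojaAlgebra t)
    (bijective_mk_carrier0ToNormalizer hnil hs ht)).symm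

theorem sub_gyojaEquiv_mem (hnil : IsNilpotent (ad ℂ g e)) (hs : IsSl2Triple h e f)
    (ht : IsMaximalToralIn (centralizer {h, e, f}) (t.map (gr0 h).incl)) (x : t.normalizer) :
    ((x : gr0 h) : g) - (gyojaEquiv hnil hs ht (LieSubmodule.Quotient.mk x) : g) ∈
      t.map (gr0 h).incl := by
  set c := gyojaEquiv hnil hs ht (LieSubmodule.Quotient.mk x) with hc
  have h1 : (gyojaEquiv hnil hs ht).symm c = LieSubmodule.Quotient.mk x := by
    rw [hc, LieEquiv.symm_apply_apply]
  have h2 : LieSubmodule.Quotient.mk (N := torusIdeal t) (carrier0ToNormalizer hs ht.prop.1 c) =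
      LieSubmodule.Quotient.mk x := h1
  have h3 := (Submodule.Quotient.eq (torusIdeal t).toSubmodule).mp h2.symm
  exact ⟨_, h3, rfl⟩

theorem exists_isEtaleAt_vinbergRep (hnil : IsNilpotent (ad ℂ g e)) (hs : IsSl2Triple h e f)
    {t : LieSubalgebra ℂ g} (ht : IsMaximalToralIn (centralizer {h, e, f}) t) :
    ∃ hc : e ∈ carrier1 h e t, IsEtaleAt (vinbergRep h e t) ⟨e, hc⟩ := by
  have het : ∀ s ∈ t, ⁅s, e⁆ = 0 := fun s hst => ht.prop.1 hst e (by simp)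
  refine ⟨⟨mem_carrierAlgebra_of_mem_gr1 hs ht.prop.1 (e_mem_gr1 hs) het, e_mem_gr1 hs⟩, ?_, ?_⟩
  · intro c d hcd
    have hcd' : ⁅(c : g), e⁆ = ⁅(d : g), e⁆ := congrArg Subtype.val hcd
    refine Subtype.ext (sub_eq_zero.mp ?_)
    have hmem := sub_mem c.2.1 d.2.1
    refine eq_zero_of_mem_carrierAlgebra_of_mem hnil hs ht hmem ?_
    -- The difference c - d commutes with h, e and t, so it lies in t as well as in c(e).
    refine mem_of_mem_centralizer_triple hnil hs ht (mem_gr0_iff.mp (sub_mem c.2.2 d.2.2)) ?_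
      fun s hst => lie_eq_zero_of_mem_carrierAlgebra hs ht.prop.1 hmem hst
    rw [lie_eq_zero_comm, sub_lie, hcd', sub_self]
  · rintro ⟨w, hw⟩
    obtain ⟨x, hx, hxt, hxe⟩ := exists_lie_e_eq_of_mem_gr1 hs ht.prop.1 hw.2 fun s hst =>
      lie_eq_zero_of_mem_carrierAlgebra hs ht.prop.1 hw.1 hst
    -- The t-component s of the preimage x kills e, so the component in c(e)_0 already reaches w;
    -- the sign comes from [e, x] = -[x, e].
    obtain ⟨s, hst, c, hc, rfl⟩ := exists_eq_add_mem_carrier0 hnil hs ht hx hxt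
    refine ⟨⟨-c, neg_mem hc⟩, Subtype.ext ?_⟩
    change ⁅-c, e⁆ = w
    rw [← hxe, lie_add, lie_eq_zero_comm.mp (het s hst), zero_add, neg_lie, lie_skew]

end GyojaVinberg

open GyojaVinberg in
theorem proposition4p1 {g : Type*} [LieRing g] [LieAlgebra ℂ g] [FiniteDimensional ℂ g]
    [LieAlgebra.IsSemisimple ℂ g] (h e f : g) (he : e ≠ 0)
    (hnil : IsNilpotent (LieAlgebra.ad ℂ g e)) (hs : IsSl2Triple h e f) :
    -- the input of the construction: `g_0` is reductive and `e` is in general position in `g_1`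
    LieAlgebra.HasCentralRadical ℂ (gr0 h) ∧
    IsGeneric (gr0 h) (⟨e, e_mem_gr1 hs⟩ : gr1 h) ∧
    -- the tori admissible in the two constructions are the same
    (∀ t₀ : LieSubalgebra ℂ g,
      IsMaximalToralIn (gr0 h ⊓ centralizer {h, e, f}) t₀ ↔
        ∃ t : LieSubalgebra ℂ (gr0 h),
          IsMaximalToralIn (stabilizer (gr0 h) (⟨e, e_mem_gr1 hs⟩ : gr1 h)) t ∧
            t.map (gr0 h).incl = t₀) ∧
    -- for each such torus the two representations coincide
    (∀ t : LieSubalgebra ℂ (gr0 h),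
      IsMaximalToralIn (stabilizer (gr0 h) (⟨e, e_mem_gr1 hs⟩ : gr1 h)) t →
      t.normalizer = centralizer (t : Set (gr0 h)) ∧
      (∃ (φ : GyojaAlgebra t ≃ₗ⁅ℂ⁆ carrier0 h e (t.map (gr0 h).incl))
         (ψ : fixedPoints (gr1 h) t ≃ₗ[ℂ] carrier1 h e (t.map (gr0 h).incl)),
        -- `φ` is inverse to the map induced by the inclusion of `c(e)_0` in the normaliser
        (∀ x : t.normalizer,
          ((x : gr0 h) : g) - (φ (LieSubmodule.Quotient.mk x) : g) ∈ t.map (gr0 h).incl) ∧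
        -- `ψ` is the identity of one and the same subspace of `g_1`
        (∀ v : fixedPoints (gr1 h) t, (ψ v : g) = ((v : gr1 h) : g)) ∧
        (∀ (x : GyojaAlgebra t) (v : fixedPoints (gr1 h) t),
          ψ (gyojaRep (gr1 h) t x v) =
            vinbergRep h e (t.map (gr0 h).incl) (φ x) (ψ v))) ∧
      -- this representation is étale, with `e` in general position
      (∃ hc : e ∈ carrier1 h e (t.map (gr0 h).incl),
        IsEtaleAt (vinbergRep h e (t.map (gr0 h).incl)) ⟨e, hc⟩)) := by
  have hmax := isMaximalToralIn_map_incl_iff hnil hs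
  refine ⟨hasCentralRadical_of_killingNondegenerateOn (killingNondegenerateOn_gr0 hnil hs),
    isGeneric_gr1 hs, fun t₀ => ?_, fun t ht => ?_⟩
  · rw [inf_eq_right.mpr centralizer_triple_le_gr0]
    constructor
    · intro ht₀
      have hmap := map_comap_incl (ht₀.prop.1.trans centralizer_triple_le_gr0)
      exact ⟨t₀.comap (gr0 h).incl, (hmax _).mp (hmap.symm ▸ ht₀), hmap⟩
    · rintro ⟨t, ht, rfl⟩
      exact (hmax t).mpr ht
  · have ht' := (hmax t).mpr ht
    refine ⟨ht.prop.2.normalizer_eq_centralizer, ?_, ?_⟩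
    · refine ⟨gyojaEquiv hnil hs ht', fixedPointsEquiv hs ht'.prop.1,
        sub_gyojaEquiv_mem hnil hs ht', fun v => rfl, fun x v => ?_⟩
      obtain ⟨x, rfl⟩ := LieSubmodule.Quotient.surjective_mk' _ x
      refine Subtype.ext ?_
      -- A representative x and its image under the isomorphism differ by an element of t, which
      -- annihilates v.
      obtain ⟨s, hst, hsx⟩ := sub_gyojaEquiv_mem hnil hs ht' x
      have h0 : ⁅(s : g), ((v : gr1 h) : g)⁆ = 0 := congrArg Subtype.val (v.2 s hst)
      rw [show ((s : gr0 h) : g) = _ from hsx, sub_lie, sub_eq_zero] at h0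
      exact h0
    · exact exists_isEtaleAt_vinbergRep hnil hs ht'
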